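/- **Model.** Let $T_s>0$, let $s_1,s_2\in L^2(\mathbb R)$ be real waveforms vanishing outside $[0,2T_s]$ with $\int_0^{2T_s}|s_j(t)|^2\,dt=1$, let the delays satisfy $0<\tau_2-\tau_1<T_s$, let $\alpha_1,\alpha_2\in\mathbb C$ be (fixed) channel gains from the two relays to the destination, and let $\hat P_s,\mathcal N_0>0$, $\mathrm{SNR}=\hat P_s/\mathcal N_0$, $m=3$ (the number of potential transmitting nodes: the source and two relays). Put $$a_1=\int_0^{T_s}s_1(t)s_1(t+T_s)\,dt,\quad d_1=\int_0^{T_s}s_2(t)s_2(t+T_s)\,dt,\quad c_0=\int_0^{2T_s}s_1(t)s_2(t-\tau_2+\tau_1)\,dt,$$ $$c_1=\int_0^{2T_s}s_1(t)s_2(t+T_s+\tau_1-\tau_2)\,dt,\quad f_1=\int_0^{T_s}s_2(t)s_1(t+T_s+\tau_2-\tau_1)\,dt,\quad c_2=\int_0^{T_s}s_1(t)s_2(t+2T_s-\tau_2+\tau_1)\,dt .$$ Let $$H_E(0)=\begin{pmatrix}|\alpha_1|^2&c_0\alpha_1^*\alpha_2\\ c_0\alpha_2^*\alpha_1&|\alpha_2|^2\end{pmatrix},\quad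 H_E(1)=H_E(-1)^\dagger=\begin{pmatrix}a_1|\alpha_1|^2&c_1\alpha_1^*\alpha_2\\ f_1\alpha_2^*\alpha_1&d_1|\alpha_2|^2\end{pmatrix},\quad H_E(2)=H_E(-2)^\dagger=\begin{pmatrix}0&c_2\alpha_1^*\alpha_2\\0&0\end{pmatrix},$$ $H_E(i)=0$ for $|i|>2$, and let $\mathcal H_E^{(n)}=(H_E(k-l))_{k,l=1}^n$. The asynchronous $2\times2$ vector-ISI channel with block length $n$ is $y^n=\mathcal H_E^{(n)}b^n+z^n$, where $b^n$ and $z^n$ are independent zero-mean proper complex Gaussian vectors in $\mathbb C^{2n}$ with covariance matrices $\frac2m\hat P_s I_{2n}$ and $\mathcal N_0\mathcal H_E^{(n)}$. Its normalized mutual information is $I^{(n)}=\frac1n I(y^n;b^n)$ ($\log$ is natural; another base rescales everything). Let $T^n(1,1),T^n(2,2),T^n(1,2)$ be the $n\times n$ Toeplitz matrices with $(k,l)$ entry $t_{k-l}$ for the sequences $t(1,1)$: $t_0=1,\ t_{\pm1}=a_1$; $t(2,2)$: $t_0=1,\ t_{\pm1}=d_1$; $t(1,2)$: $t_{-1}=f_1,\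 t_0=c_0,\ t_1=c_1,\ t_2=c_2$ (all other terms zero); let $T^n(2,1)=T^n(1,2)^\dagger$, and $$\mathcal T^{(2n)}=\begin{pmatrix}|\alpha_1|^2T^n(1,1)&\alpha_1\alpha_2^*T^n(1,2)\\ \alpha_1^*\alpha_2T^n(2,1)&|\alpha_2|^2T^n(2,2)\end{pmatrix}.$$ **Theorem 6.** For every $n$, $I(y^n;b^n)$ is finite and $I(y^n;b^n)=\log\det\bigl(I_{2n}+\tfrac2m\mathrm{SNR}\,\mathcal T^{(2n)}\bigr)$. As $n\to\infty$, $$\lim_{n\to\infty}I^{(n)}=\lim_{n\to\infty}\frac1n\log\det\Bigl(I_{2n}+\frac2m\mathrm{SNR}\,\mathcal T^{(2n)}\Bigr)=\frac1{2\pi}\int_{-\pi}^{\pi}\sum_{j=1}^2\log\Bigl[1+\frac2m\mathrm{SNR}\cdot\nu_j(T_E(\omega))\Bigr]d\omega,$$ the integrand being integrable, where $\nu_j(T_E(\omega))$ is the $j$th largest eigenvalue of the Hermitian matrix $$T_E(\omega)=\begin{pmatrix}|\alpha_1|^2t^{(1,1)}(\omega)&\alpha_1\alpha_2^*t^{(1,2)}(\omega)\\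 \alpha_1^*\alpha_2t^{(2,1)}(\omega)&|\alpha_2|^2t^{(2,2)}(\omega)\end{pmatrix}$$ and $t^{(j,l)}(\omega)=\sum_k t_k(j,l)e^{-ik\omega}$ is the discrete-time Fourier transform of the sequence generating $T^n(j,l)$; explicitly $$t^{(1,1)}(\omega)=1+a_1e^{-i\omega}+a_1e^{i\omega},\qquad t^{(2,2)}(\omega)=1+d_1e^{-i\omega}+d_1e^{i\omega},$$ $$t^{(1,2)}(\omega)=c_1e^{-i\omega}+c_2e^{-2i\omega}+c_0+f_1e^{i\omega}=\bigl(t^{(2,1)}(\omega)\bigr)^*.$$ -/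

import Mathlib

open MeasureTheory ProbabilityTheory

/-- The mutual information `I(X; Y)` (in nats) of two random variables: the Kullback-Leibler
divergence of their joint law from the product of their laws. -/
noncomputable def mutualInfo {Ω E F : Type*} [MeasurableSpace Ω] [MeasurableSpace E]
    [MeasurableSpace F] (P : Measure Ω) (X : Ω → E) (Y : Ω → F) : ENNReal :=
  InformationTheory.klDiv (P.map fun w => (X w, Y w)) ((P.map X).prod (P.map Y))

/-- `X` is a zero-mean proper (circularly symmetric) complex Gaussian random vector with
covariance matrix `E[X X†] = S`. -/
structure IsProperComplexGaussian {Ω ι : Type*} [MeasurableSpace Ω] [Fintype ι]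
    (P : Measure Ω) (X : Ω → ι → ℂ) (S : Matrix ι ι ℂ) : Prop where
  gaussian : HasGaussianLaw X P
  mean : ∀ i, ∫ w, X w i ∂P = 0
  covariance : ∀ i j, ∫ w, X w i * starRingEnd ℂ (X w j) ∂P = S i j
  pseudoCovariance : ∀ i j, ∫ w, X w i * X w j ∂P = 0

/-- The second hop of the relay network: two relays (indices `0`, `1`) send linearly modulated
signals with waveforms `s 0`, `s 1` over flat channels with gains `α 0`, `α 1` and delays
`τ 0`, `τ 1`. -/
structure RelayLink where
  /-- symbol period -/
  Ts : ℝ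
  /-- baseband waveforms -/
  s : Fin 2 → ℝ → ℝ
  /-- delays -/
  τ : Fin 2 → ℝ
  /-- channel gains -/
  α : Fin 2 → ℂ
  /-- discrete-time transmission power of a node -/
  Ps : ℝ
  /-- noise power spectral density -/
  N0 : ℝ
  Ts_pos : 0 < Ts
  s_support : ∀ j, ∀ t, t ∉ Set.Icc 0 (2 * Ts) → s j t = 0
  s_memLp : ∀ j, MemLp (s j) 2 volume
  s_energy : ∀ j, ∫ t in (0 : ℝ)..(2 * Ts), |s j t| ^ 2 = 1
  delay_pos : 0 < τ 1 - τ 0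
  delay_lt : τ 1 - τ 0 < Ts
  Ps_pos : 0 < Ps
  N0_pos : 0 < N0

/-- The number of potential transmitting nodes (the source and `2` relays). -/
def numTransmitters : ℕ := 3

namespace RelayLink

variable (L : RelayLink)

noncomputable section

/-- `SNR = P̂ₛ / N₀`. -/
def snr : ℝ := L.Ps / L.N0

/-- Power `(2 / m) P̂ₛ` of each symbol sent by a relay. -/
def symbolPower : ℝ := 2 / (numTransmitters : ℝ) * L.Ps

/-! Waveform correlation coefficients. -/

def a₁ : ℝ := ∫ t in (0 : ℝ)..L.Ts, L.s 0 t * L.s 0 (t + L.Ts)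

def d₁ : ℝ := ∫ t in (0 : ℝ)..L.Ts, L.s 1 t * L.s 1 (t + L.Ts)

def c₀ : ℝ := ∫ t in (0 : ℝ)..(2 * L.Ts), L.s 0 t * L.s 1 (t - L.τ 1 + L.τ 0)

def c₁ : ℝ := ∫ t in (0 : ℝ)..(2 * L.Ts), L.s 0 t * L.s 1 (t + L.Ts + L.τ 0 - L.τ 1)

def f₁ : ℝ := ∫ t in (0 : ℝ)..L.Ts, L.s 1 t * L.s 0 (t + L.Ts + L.τ 1 - L.τ 0)

def c₂ : ℝ := ∫ t in (0 : ℝ)..L.Ts, L.s 0 t * L.s 1 (t + 2 * L.Ts - L.τ 1 + L.τ 0)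

/-! The vector inter-symbol-interference channel. -/

/-- `H_E(0)`. -/
def HE0 : Matrix (Fin 2) (Fin 2) ℂ :=
  !![((‖L.α 0‖ ^ 2 : ℝ) : ℂ), L.c₀ * (starRingEnd ℂ (L.α 0) * L.α 1);
     L.c₀ * (starRingEnd ℂ (L.α 1) * L.α 0), ((‖L.α 1‖ ^ 2 : ℝ) : ℂ)]

/-- `H_E(1)`. -/
def HE1 : Matrix (Fin 2) (Fin 2) ℂ :=
  !![L.a₁ * ((‖L.α 0‖ ^ 2 : ℝ) : ℂ), L.c₁ * (starRingEnd ℂ (L.α 0) * L.α 1);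
     L.f₁ * (starRingEnd ℂ (L.α 1) * L.α 0), L.d₁ * ((‖L.α 1‖ ^ 2 : ℝ) : ℂ)]

/-- `H_E(2)`. -/
def HE2 : Matrix (Fin 2) (Fin 2) ℂ :=
  !![0, L.c₂ * (starRingEnd ℂ (L.α 0) * L.α 1); 0, 0]

/-- The matrix taps `H_E(i)`, with `H_E(-i) = H_E(i)†` and `H_E(i) = 0` for `|i| > 2`. -/
def HE (i : ℤ) : Matrix (Fin 2) (Fin 2) ℂ :=
  if i = 0 then L.HE0
  else if i = 1 then L.HE1
  else if i = -1 then L.HE1.conjTranspose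
  else if i = 2 then L.HE2
  else if i = -2 then L.HE2.conjTranspose
  else 0

/-- The block Toeplitz matrix of the channel over `n` symbol periods; the `(k, l)` block is
`H_E(k - l)`. -/
def channelMatrix (n : ℕ) : Matrix (Fin n × Fin 2) (Fin n × Fin 2) ℂ :=
  Matrix.of fun x y => L.HE ((x.1 : ℤ) - (y.1 : ℤ)) x.2 y.2

/-- The channel output `y = H_E b + z` over `n` symbol periods. -/
def output {Ω : Type*} (n : ℕ) (b z : Ω → Fin n × Fin 2 → ℂ) (w : Ω) : Fin n × Fin 2 → ℂ :=
  (L.channelMatrix n).mulVec (b w) + z w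

/-! The Toeplitz blocks and their symbol. -/

/-- Generating sequence of the `(1,1)` block. -/
def t₁₁ (k : ℤ) : ℂ := if k = 0 then 1 else if k = 1 ∨ k = -1 then L.a₁ else 0

/-- Generating sequence of the `(2,2)` block. -/
def t₂₂ (k : ℤ) : ℂ := if k = 0 then 1 else if k = 1 ∨ k = -1 then L.d₁ else 0

/-- Generating sequence of the `(1,2)` block. -/
def t₁₂ (k : ℤ) : ℂ :=
  if k = 0 then L.c₀ else if k = 1 then L.c₁ else if k = 2 then L.c₂
  else if k = -1 then L.f₁ else 0

/-- Generating sequence of the `(2,1)` block, the conjugate transpose of the `(1,2)` block. -/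
def t₂₁ (k : ℤ) : ℂ := starRingEnd ℂ (L.t₁₂ (-k))

/-- The `n × n` Toeplitz matrix with entries `t (k - l)`. -/
def toeplitz (t : ℤ → ℂ) (n : ℕ) : Matrix (Fin n) (Fin n) ℂ :=
  Matrix.of fun k l => t ((k : ℤ) - (l : ℤ))

/-- The `2n × 2n` Hermitian matrix `T^(2n)` made of four `n × n` Toeplitz blocks. -/
def blockMatrix (n : ℕ) : Matrix (Fin n ⊕ Fin n) (Fin n ⊕ Fin n) ℂ :=
  Matrix.fromBlocks
    (((‖L.α 0‖ ^ 2 : ℝ) : ℂ) • toeplitz L.t₁₁ n)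
    ((L.α 0 * starRingEnd ℂ (L.α 1)) • toeplitz L.t₁₂ n)
    ((starRingEnd ℂ (L.α 0) * L.α 1) • toeplitz L.t₂₁ n)
    (((‖L.α 1‖ ^ 2 : ℝ) : ℂ) • toeplitz L.t₂₂ n)

/-- `log det (I + (2 / m) SNR T^(2n))`. The matrix is Hermitian, so its determinant is real. -/
def logDet (n : ℕ) : ℝ :=
  Real.log
    (1 + (((2 / (numTransmitters : ℝ)) * L.snr : ℝ) : ℂ) • L.blockMatrix n).det.re

/-- Discrete-time Fourier transform `∑ₖ tₖ e^{-ikω}`. -/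
def dtft (t : ℤ → ℂ) (ω : ℝ) : ℂ :=
  ∑' k : ℤ, t k * Complex.exp (-(Complex.I * k * ω))

/-- The matrix symbol `T_E(ω)`. -/
def symbol (ω : ℝ) : Matrix (Fin 2) (Fin 2) ℂ :=
  !![((‖L.α 0‖ ^ 2 : ℝ) : ℂ) * dtft L.t₁₁ ω,
     L.α 0 * starRingEnd ℂ (L.α 1) * dtft L.t₁₂ ω;
     starRingEnd ℂ (L.α 0) * L.α 1 * dtft L.t₂₁ ω,
     ((‖L.α 1‖ ^ 2 : ℝ) : ℂ) * dtft L.t₂₂ ω]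

theorem conj_dtft (t u : ℤ → ℂ) (h : ∀ k, u k = starRingEnd ℂ (t (-k))) (ω : ℝ) :
    starRingEnd ℂ (dtft t ω) = dtft u ω := by
  unfold dtft
  rw [Complex.conj_tsum, ← (Equiv.neg ℤ).tsum_eq]
  refine tsum_congr fun k => ?_
  simp [h, ← Complex.exp_conj]

theorem symbol_isHermitian (ω : ℝ) : (L.symbol ω).IsHermitian := by
  have h11 : starRingEnd ℂ (dtft L.t₁₁ ω) = dtft L.t₁₁ ω := by
    refine conj_dtft _ _ (fun k => ?_) ω
    unfold t₁₁
    split_ifs <;> first | (exfalso; omega) | simp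
  have h22 : starRingEnd ℂ (dtft L.t₂₂ ω) = dtft L.t₂₂ ω := by
    refine conj_dtft _ _ (fun k => ?_) ω
    unfold t₂₂
    split_ifs <;> first | (exfalso; omega) | simp
  have h12 : starRingEnd ℂ (dtft L.t₁₂ ω) = dtft L.t₂₁ ω :=
    conj_dtft _ _ (fun k => rfl) ω
  have h21 : starRingEnd ℂ (dtft L.t₂₁ ω) = dtft L.t₁₂ ω := by
    rw [← h12, Complex.conj_conj]
  ext i j
  fin_cases i <;> fin_cases j <;> simp [symbol, h11, h22, h12, h21]

/-- The `j`-th largest eigenvalue of `T_E(ω)`. -/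
def symbolEigenvalue (ω : ℝ) (j : Fin 2) : ℝ :=
  (L.symbol_isHermitian ω).eigenvalues₀ (Fin.cast (Fintype.card_fin 2).symm j)

/-- `∑ⱼ log (1 + (2 / m) SNR νⱼ(T_E(ω)))`. -/
def rateDensity (ω : ℝ) : ℝ :=
  ∑ j : Fin 2, Real.log (1 + 2 / (numTransmitters : ℝ) * L.snr * L.symbolEigenvalue ω j)

end

end RelayLink

/-!
A unitary matrix diagonalizing `H` preserves proper complex Gaussian vectors and turns the channel
`y = H b + z`, whose noise has covariance `N₀ H`, into parallel channels with inputs of variance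
`p`, gains `d i` and noise variances `N₀ d i`, where `d i` are the eigenvalues of `H`. Their real
and imaginary parts are independent scalar Gaussian channels, so that
`I(y; b) = ∑ i, log (1 + p d i / N₀) = log det (1 + (p / N₀) H)`.

When `H` is the banded block Toeplitz matrix with `n` block rows, it is a principal submatrix of a
positive semidefinite block circulant matrix with `n + r + 1` block rows, and the Schur complement
bounds the difference of the two log-determinants independently of `n`. The discrete Fourier
transform diagonalizes the circulant matrix by blocks, so its log-determinant is a sum over samples
of the symbol and, once normalized, a Riemann sum of the limiting integral.

For the relay link, `T^(2n)` and `T_E` are, up to reindexing, the transposes of the channel matrix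
and of its symbol.
-/

section Determinants

open Matrix
open scoped ComplexOrder

variable {𝕜 m k : Type*} [RCLike 𝕜] [Fintype m] [DecidableEq m] {A : Matrix m m 𝕜}
  {B : Matrix m k 𝕜} {D : Matrix k k 𝕜}

lemma posSemidef_schur_one_add [Finite k] (h : (fromBlocks A B Bᴴ D).PosSemidef) :
    (D - Bᴴ * (1 + A)⁻¹ * B).PosSemidef := by
  have hA : (1 + A).PosDef := PosDef.one.add_posSemidef (h.submatrix Sum.inl)
  let := hA.isUnit.invertible
  classical
  have hone : (fromBlocks 1 0 0 0 : Matrix (m ⊕ k) (m ⊕ k) 𝕜).PosSemidef := by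
    rw [← diagonal_one, ← diagonal_zero, fromBlocks_diagonal]
    exact PosSemidef.diagonal (by rintro (i | i) <;> simp)
  rw [← hA.fromBlocks₁₁ B D]
  simpa [fromBlocks_add] using hone.add h

lemma det_one_add_smul_eq_prod_eigenvalues {H : Matrix m m 𝕜} (hH : H.IsHermitian) (γ : 𝕜) :
    (1 + γ • H).det = ∏ i, (1 + γ * (hH.eigenvalues i : 𝕜)) := by
  let Φ := Unitary.conjStarAlgAut 𝕜 (Matrix m m 𝕜) hH.eigenvectorUnitary
  have hΦ : 1 + γ • H = Φ (diagonal fun i => 1 + γ * (hH.eigenvalues i : 𝕜)) := by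
    conv_lhs => rw [hH.spectral_theorem]
    rw [← map_one Φ, ← map_smul Φ, ← map_add Φ, ← diagonal_one, ← diagonal_smul, diagonal_add]
    rfl
  rw [hΦ, Unitary.conjStarAlgAut_apply, det_mul_right_comm, Unitary.mul_star_self_of_mem
    hH.eigenvectorUnitary.2, one_mul, det_diagonal]

lemma one_le_det_one_add {H : Matrix m m 𝕜} (hH : H.PosSemidef) : 1 ≤ (1 + H).det := by
  have hdet := det_one_add_smul_eq_prod_eigenvalues hH.isHermitian 1
  simp only [one_smul, one_mul] at hdet
  have hprod : 1 ≤ ∏ i, (1 + hH.isHermitian.eigenvalues i) :=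
    Finset.one_le_prod fun i _ => le_add_of_nonneg_right (hH.eigenvalues_nonneg i)
  rw [hdet]
  exact_mod_cast hprod

lemma det_le_trace_pow_card {H : Matrix m m 𝕜} (hH : H.PosSemidef) :
    H.det ≤ H.trace ^ Fintype.card m := by
  have hprod : ∏ i, hH.isHermitian.eigenvalues i ≤
      (∑ i, hH.isHermitian.eigenvalues i) ^ Fintype.card m :=
    (Finset.prod_le_prod (fun i _ => hH.eigenvalues_nonneg i) fun i hi =>
      Finset.single_le_sum (fun j _ => hH.eigenvalues_nonneg j) hi).trans_eq
      (Finset.prod_const _)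
  rw [hH.isHermitian.det_eq_prod_eigenvalues, hH.isHermitian.trace_eq_sum_eigenvalues]
  exact_mod_cast hprod

variable [Fintype k] [DecidableEq k]

lemma det_one_add_fromBlocks_eq_mul_schur (hA : A.PosSemidef) :
    (1 + fromBlocks A B Bᴴ D).det =
      (1 + A).det * (1 + (D - Bᴴ * (1 + A)⁻¹ * B)).det := by
  let := (PosDef.one.add_posSemidef hA).isUnit.invertible
  rw [← fromBlocks_one, fromBlocks_add, zero_add, zero_add, det_fromBlocks₁₁,
    invOf_eq_nonsing_inv, add_sub_assoc]

/- The ratio of the two determinants is `det (1 + S)`, where `S` is the Schur complement of `1 + A`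
and satisfies `0 ≤ S ≤ D`. -/
lemma det_one_add_le_det_one_add_fromBlocks (h : (fromBlocks A B Bᴴ D).PosSemidef) :
    (1 + A).det ≤ (1 + fromBlocks A B Bᴴ D).det := by
  have hA : A.PosSemidef := h.submatrix Sum.inl
  rw [det_one_add_fromBlocks_eq_mul_schur hA]
  exact le_mul_of_one_le_right (zero_le_one.trans (one_le_det_one_add hA))
    (one_le_det_one_add (posSemidef_schur_one_add h))

lemma det_one_add_fromBlocks_le (h : (fromBlocks A B Bᴴ D).PosSemidef) :
    (1 + fromBlocks A B Bᴴ D).det ≤ (1 + A).det * (1 + D).trace ^ Fintype.card k := by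
  have hA : A.PosSemidef := h.submatrix Sum.inl
  have hS := PosSemidef.one.add (posSemidef_schur_one_add h)
  have htrace : (1 + (D - Bᴴ * (1 + A)⁻¹ * B)).trace ≤ (1 + D).trace := by
    rw [← add_sub_assoc, trace_sub]
    exact sub_le_self _ ((PosDef.one.add_posSemidef hA).inv.posSemidef.conjTranspose_mul_mul_same
      B).trace_nonneg
  rw [det_one_add_fromBlocks_eq_mul_schur hA]
  exact mul_le_mul_of_nonneg_left
    ((det_le_trace_pow_card hS).trans (pow_le_pow_left₀ hS.trace_nonneg htrace _))
    (zero_le_one.trans (one_le_det_one_add hA))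

end Determinants

section RiemannSums

open Filter Topology

variable {E : Type*} [NormedAddCommGroup E] [NormedSpace ℝ E] [CompleteSpace E] {g : ℝ → E}

lemma norm_integral_sub_smul_left_endpoint_le {a b ε : ℝ} (hab : a ≤ b)
    (hg : IntervalIntegrable g volume a b) (hε : ∀ x ∈ Set.Ioc a b, ‖g x - g a‖ ≤ ε) :
    ‖(∫ x in a..b, g x) - (b - a) • g a‖ ≤ ε * (b - a) := by
  rw [← intervalIntegral.integral_const, ← intervalIntegral.integral_sub hg
    intervalIntegrable_const, ← abs_of_nonneg (sub_nonneg.2 hab)]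
  exact intervalIntegral.norm_integral_le_of_norm_le_const fun x hx =>
    hε x (by rwa [Set.uIoc_of_le hab] at hx)

lemma norm_integral_sub_riemannSum_le {T ε : ℝ} (hT : 0 < T) {N : ℕ} (hN : N ≠ 0)
    (hg : ContinuousOn g (Set.Icc 0 T))
    (hε : ∀ x ∈ Set.Icc 0 T, ∀ y ∈ Set.Icc 0 T, |x - y| ≤ T / N → ‖g x - g y‖ ≤ ε) :
    ‖(∫ x in (0 : ℝ)..T, g x) - (T / N) • ∑ j ∈ Finset.range N, g (T * j / N)‖ ≤ ε * T := by
  have hNpos : (0 : ℝ) < N := by positivity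
  let u : ℕ → ℝ := fun j => T * j / N
  have hlen (j : ℕ) : u (j + 1) - u j = T / N := by simp only [u]; push_cast; ring
  have hstep : 0 < T / N := by positivity
  have hcell {j : ℕ} (hj : j < N) : Set.Icc (u j) (u (j + 1)) ⊆ Set.Icc 0 T := by
    refine Set.Icc_subset_Icc (by positivity) ?_
    rw [div_le_iff₀ hNpos]
    gcongr
    exact hj
  have hint {j : ℕ} (hj : j < N) : IntervalIntegrable g volume (u j) (u (j + 1)) :=
    (hg.mono (hcell hj)).intervalIntegrable_of_Icc (by linarith [hlen j])
  have hsplit : ∫ x in (0 : ℝ)..T, g x = ∑ j ∈ Finset.range N, ∫ x in u j..u (j + 1), g x := by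
    rw [intervalIntegral.sum_integral_adjacent_intervals (a := u) fun _ hj => hint hj]
    simp [u, hNpos.ne']
  rw [hsplit, Finset.smul_sum, ← Finset.sum_sub_distrib]
  calc ‖∑ j ∈ Finset.range N, ((∫ x in u j..u (j + 1), g x) - (T / N) • g (u j))‖
      ≤ ∑ _ ∈ Finset.range N, ε * (T / N) := by
        refine norm_sum_le_of_le _ fun j hj => ?_
        replace hj := Finset.mem_range.1 hj
        have hle : u j ≤ u (j + 1) := by linarith [hlen j]
        rw [← hlen j]
        refine norm_integral_sub_smul_left_endpoint_le hle (hint hj) fun x hx => ?_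
        refine hε x (hcell hj ⟨hx.1.le, hx.2⟩) _ (hcell hj ⟨le_rfl, hle⟩) ?_
        rw [abs_of_pos (sub_pos.2 hx.1), ← hlen j]
        linarith [hx.2]
    _ = ε * T := by
        rw [Finset.sum_const, Finset.card_range, nsmul_eq_mul]
        field_simp

lemma tendsto_riemannSum {T : ℝ} (hT : 0 < T) (hg : ContinuousOn g (Set.Icc 0 T)) :
    Tendsto (fun N : ℕ => (T / N) • ∑ j ∈ Finset.range N, g (T * j / N)) atTop
      (𝓝 (∫ x in (0 : ℝ)..T, g x)) := by
  rw [Metric.tendsto_atTop]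
  intro ε hε
  obtain ⟨δ, hδ, hgδ⟩ := Metric.uniformContinuousOn_iff.1
    (isCompact_Icc.uniformContinuousOn_of_continuous hg) (ε / (2 * T)) (by positivity)
  obtain ⟨N₀, hN₀⟩ := eventually_atTop.1
    ((tendsto_const_div_atTop_nhds_zero_nat T).eventually_lt_const hδ)
  refine ⟨N₀ + 1, fun N hN => ?_⟩
  rw [dist_comm, dist_eq_norm]
  calc ‖(∫ x in (0 : ℝ)..T, g x) - (T / N) • ∑ j ∈ Finset.range N, g (T * j / N)‖
      ≤ ε / (2 * T) * T := norm_integral_sub_riemannSum_le hT (by omega) hg fun x hx y hy hxy => by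
        rw [← dist_eq_norm]
        exact (hgδ x hx y hy (hxy.trans_lt (hN₀ N (by omega)))).le
    _ = ε / 2 := by field_simp
    _ < ε := half_lt_self hε

lemma tendsto_inv_mul_of_abs_sub_shift_le {u v : ℕ → ℝ} {ℓ M : ℝ} {r : ℕ}
    (hv : Tendsto (fun n : ℕ => 1 / (n : ℝ) * v n) atTop (𝓝 ℓ))
    (huv : ∀ n, |u n - v (n + r)| ≤ M) :
    Tendsto (fun n : ℕ => 1 / (n : ℝ) * u n) atTop (𝓝 ℓ) := by
  have herror : Tendsto (fun n : ℕ => 1 / (n : ℝ) * (u n - v (n + r))) atTop (𝓝 0) :=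
    tendsto_one_div_atTop_nhds_zero_nat.zero_mul_isBoundedUnder_le
      ⟨M, eventually_map.2 (Eventually.of_forall huv)⟩
  have hratio : Tendsto (fun n : ℕ => 1 + (r : ℝ) / n) atTop (𝓝 1) := by
    simpa using (tendsto_const_div_atTop_nhds_zero_nat (r : ℝ)).const_add 1
  have hsum := herror.add (hratio.mul (hv.comp (tendsto_add_atTop_nat r)))
  rw [zero_add, one_mul] at hsum
  refine hsum.congr' ?_
  filter_upwards [eventually_gt_atTop 0] with n hn
  have : (n : ℝ) ≠ 0 := by positivity
  have : (n : ℝ) + r ≠ 0 := by positivity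
  simp only [Function.comp_apply]
  push_cast
  field_simp
  ring

end RiemannSums

section LogDeterminants

open Matrix
open scoped ComplexOrder

variable {m k : Type*} [Fintype m] [DecidableEq m] {H : Matrix m m ℂ}

/-- The number `log det (1 + H)` attached to a positive semidefinite matrix `H`; the real part is
harmless since the determinant is real. -/
noncomputable def logDetOneAdd (H : Matrix m m ℂ) : ℝ :=
  Real.log (1 + H).det.re

lemma logDetOneAdd_reindex [Fintype k] [DecidableEq k] (e : m ≃ k) (H : Matrix k k ℂ) :
    logDetOneAdd (H.submatrix e e) = logDetOneAdd H := by
  rw [logDetOneAdd, logDetOneAdd, ← submatrix_one_equiv e, ← det_submatrix_equiv_self e (1 + H),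
    submatrix_add]
  rfl

lemma logDetOneAdd_transpose (H : Matrix m m ℂ) : logDetOneAdd Hᵀ = logDetOneAdd H := by
  rw [logDetOneAdd, logDetOneAdd, ← det_transpose (1 + H), transpose_add, transpose_one]

lemma ofReal_re_det_one_add (hH : H.PosSemidef) : ((1 + H).det.re : ℂ) = (1 + H).det :=
  (Complex.eq_re_of_ofReal_le (r := 1) (by exact_mod_cast one_le_det_one_add hH)).symm

lemma one_le_re_det_one_add (hH : H.PosSemidef) : 1 ≤ (1 + H).det.re :=
  (Complex.le_def.1 (one_le_det_one_add hH)).1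

lemma logDetOneAdd_nonneg (hH : H.PosSemidef) : 0 ≤ logDetOneAdd H :=
  Real.log_nonneg (one_le_re_det_one_add hH)

lemma logDetOneAdd_smul_eq_sum_log_eigenvalues (hH : H.PosSemidef) {γ : ℝ} (hγ : 0 ≤ γ) :
    logDetOneAdd ((γ : ℂ) • H) = ∑ i, Real.log (1 + γ * hH.isHermitian.eigenvalues i) := by
  have hdet : (1 + (γ : ℂ) • H).det = (∏ i, (1 + γ * hH.isHermitian.eigenvalues i) : ℝ) := by
    rw [det_one_add_smul_eq_prod_eigenvalues hH.isHermitian]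
    push_cast
    rfl
  rw [logDetOneAdd, hdet, Complex.ofReal_re, Real.log_prod fun i _ => ?_]
  exact (add_pos_of_pos_of_nonneg one_pos (mul_nonneg hγ (hH.eigenvalues_nonneg i))).ne'

lemma continuous_logDetOneAdd {X : Type*} [TopologicalSpace X] {f : X → Matrix m m ℂ}
    (hf : Continuous f) (hpos : ∀ x, (f x).PosSemidef) : Continuous fun x => logDetOneAdd (f x) :=
  (Complex.continuous_re.comp (continuous_const.add hf).matrix_det).log fun x =>
    (one_pos.trans_le (one_le_re_det_one_add (hpos x))).ne'

lemma abs_logDetOneAdd_sub_fromBlocks_le [Fintype k] [DecidableEq k] {A : Matrix m m ℂ}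
    {B : Matrix m k ℂ} {D : Matrix k k ℂ} (h : (fromBlocks A B Bᴴ D).PosSemidef) :
    |logDetOneAdd A - logDetOneAdd (fromBlocks A B Bᴴ D)| ≤
      Fintype.card k * Real.log (1 + D).trace.re := by
  have hA : A.PosSemidef := h.submatrix Sum.inl
  have hD : D.PosSemidef := h.submatrix Sum.inr
  have htrace : ((1 + D).trace.re : ℂ) = (1 + D).trace :=
    (Complex.eq_re_of_ofReal_le (r := 0)
      (by exact_mod_cast (PosSemidef.one.add hD).trace_nonneg)).symm
  have hlower := (Complex.le_def.1 (det_one_add_le_det_one_add_fromBlocks h)).1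
  have hupper : (1 + fromBlocks A B Bᴴ D).det.re ≤
      (1 + A).det.re * (1 + D).trace.re ^ Fintype.card k := by
    have := det_one_add_fromBlocks_le h
    rw [← ofReal_re_det_one_add hA, ← ofReal_re_det_one_add h, ← htrace] at this
    exact_mod_cast this
  have hApos := one_pos.trans_le (one_le_re_det_one_add hA)
  have hpos := one_pos.trans_le (one_le_re_det_one_add h)
  have hpow : (1 + D).trace.re ^ Fintype.card k ≠ 0 := fun h0 => by
    rw [h0, mul_zero] at hupper
    exact hpos.not_ge hupper
  rw [logDetOneAdd, logDetOneAdd, abs_sub_comm,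
    abs_of_nonneg (sub_nonneg.2 (Real.log_le_log hApos hlower)), sub_le_iff_le_add',
    ← Real.log_pow, ← Real.log_mul hApos.ne' hpow]
  exact Real.log_le_log hpos hupper

end LogDeterminants

section Symbol

open Matrix
open scoped ComplexOrder

variable {q : Type*}

/-- The block Toeplitz matrix with `n` block rows whose `(k, l)` block is `H (k - l)`. -/
def blockToeplitz (H : ℤ → Matrix q q ℂ) (n : ℕ) : Matrix (Fin n × q) (Fin n × q) ℂ :=
  of fun x y => H ((x.1 : ℤ) - (y.1 : ℤ)) x.2 y.2

/-- The symbol of a banded sequence of blocks, that is, the trigonometric polynomial whose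
coefficients are the blocks `H d`, `|d| ≤ r`. The exponent carries no minus sign, so this is the
discrete-time Fourier transform of `H` at `-ω`. -/
noncomputable def blockSymbol (H : ℤ → Matrix q q ℂ) (r : ℕ) (ω : ℝ) : Matrix q q ℂ :=
  ∑ d ∈ Finset.Icc (-(r : ℤ)) r, Complex.exp (Complex.I * d * ω) • H d

variable {H : ℤ → Matrix q q ℂ} {r : ℕ}

lemma blockSymbol_apply (ω : ℝ) (i j : q) :
    blockSymbol H r ω i j =
      ∑ d ∈ Finset.Icc (-(r : ℤ)) r, Complex.exp (Complex.I * d * ω) * H d i j := by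
  simp [blockSymbol, Matrix.sum_apply]

lemma continuous_blockSymbol : Continuous (blockSymbol H r) := by
  unfold blockSymbol
  fun_prop

lemma periodic_blockSymbol : Function.Periodic (blockSymbol H r) (2 * Real.pi) := fun ω => by
  refine Finset.sum_congr rfl fun d _ => congrArg (· • H d) ?_
  rw [Complex.exp_eq_exp_iff_exists_int]
  exact ⟨d, by push_cast; ring⟩

lemma isHermitian_blockSymbol (hH : ∀ d, H (-d) = (H d)ᴴ) (ω : ℝ) :
    (blockSymbol H r ω).IsHermitian := by
  rw [IsHermitian, blockSymbol, conjTranspose_sum]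
  refine Finset.sum_equiv (Equiv.neg ℤ) (fun d => ?_) fun d _ => ?_
  · rw [Equiv.neg_apply, Finset.mem_Icc, Finset.mem_Icc]
    omega
  · rw [conjTranspose_smul, ← hH, Complex.star_def, ← Complex.exp_conj]
    simp

lemma sum_Icc_neg_self_succ {M : Type*} [AddCommMonoid M] (φ : ℤ → M) (n : ℕ) :
    ∑ d ∈ Finset.Icc (-((n + 1 : ℕ) : ℤ)) (n + 1 : ℕ), φ d =
      ∑ d ∈ Finset.Icc (-(n : ℤ)) n, φ d + (φ (n + 1) + φ (-(n + 1))) := by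
  have hIcc : Finset.Icc (-((n + 1 : ℕ) : ℤ)) (n + 1 : ℕ) =
      insert ((n : ℤ) + 1) (insert (-((n : ℤ) + 1)) (Finset.Icc (-(n : ℤ)) n)) := by
    ext d
    simp only [Finset.mem_insert, Finset.mem_Icc]
    omega
  rw [hIcc, Finset.sum_insert (by simp; omega), Finset.sum_insert (by simp)]
  abel

lemma sum_sum_sub_range_succ {M : Type*} [AddCommMonoid M] (φ : ℤ → M) (n : ℕ) :
    ∑ k ∈ Finset.range (n + 1), ∑ l ∈ Finset.range (n + 1), φ (k - l) =
      ∑ k ∈ Finset.range n, ∑ l ∈ Finset.range n, φ (k - l) +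
        ∑ d ∈ Finset.Icc (-(n : ℤ)) n, φ d := by
  have hband : ∑ d ∈ Finset.Icc (-(n : ℤ)) n, φ d =
      ∑ k ∈ Finset.range n, φ (k - n) + (∑ l ∈ Finset.range n, φ (n - l) + φ 0) := by
    induction n with
    | zero => simp
    | succ n ih =>
      rw [sum_Icc_neg_self_succ, ih, Finset.sum_range_succ', Finset.sum_range_succ' (n := n)]
      simp only [Nat.cast_zero, zero_sub, sub_zero, Nat.cast_add, Nat.cast_one,
        add_sub_add_right_eq_sub]
      ac_rfl
  simp only [Finset.sum_range_succ, Finset.sum_add_distrib, sub_self, hband]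
  abel

lemma dotProduct_blockToeplitz_mulVec_exp [Fintype q] (n : ℕ) (ω : ℝ) (x : q → ℂ) :
    star (fun y : Fin n × q => Complex.exp (-(Complex.I * (y.1 : ℕ) * ω)) * x y.2) ⬝ᵥ
        (blockToeplitz H n *ᵥ fun y => Complex.exp (-(Complex.I * (y.1 : ℕ) * ω)) * x y.2) =
      ∑ k : Fin n, ∑ l : Fin n,
        Complex.exp (Complex.I * (k - l : ℤ) * ω) * (star x ⬝ᵥ (H (k - l) *ᵥ x)) := by
  have hphase (k l : ℕ) : Complex.exp (Complex.I * (k - l : ℤ) * ω) =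
      star (Complex.exp (-(Complex.I * k * ω))) * Complex.exp (-(Complex.I * l * ω)) := by
    rw [Complex.star_def, ← Complex.exp_conj, ← Complex.exp_add]
    congr 1
    simp
    ring
  simp only [dotProduct, mulVec, Fintype.sum_prod_type, Finset.mul_sum, Pi.star_apply, hphase,
    star_mul', blockToeplitz, of_apply]
  refine Finset.sum_congr rfl fun k _ => ?_
  rw [Finset.sum_comm]
  refine Finset.sum_congr rfl fun l _ => Finset.sum_congr rfl fun i _ =>
    Finset.sum_congr rfl fun j _ => ?_
  ring

/- Appending one index to the block Toeplitz form evaluated at the character of frequency `ω` adds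
the form of the symbol at `ω`, so the latter cannot be negative. -/
lemma posSemidef_blockSymbol [Finite q] (hH : ∀ d, H (-d) = (H d)ᴴ)
    (hr : ∀ d : ℤ, r < |d| → H d = 0) (hpos : ∀ n, (blockToeplitz H n).PosSemidef) (ω : ℝ) :
    (blockSymbol H r ω).PosSemidef := by
  have := Fintype.ofFinite q
  refine PosSemidef.of_dotProduct_mulVec_nonneg (isHermitian_blockSymbol hH ω) fun x => ?_
  let φ : ℤ → ℂ := fun d => Complex.exp (Complex.I * d * ω) * (star x ⬝ᵥ (H d *ᵥ x))
  let Q : ℕ → ℂ := fun n => ∑ k ∈ Finset.range n, ∑ l ∈ Finset.range n, φ (k - l)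
  have hQ (n : ℕ) : 0 ≤ Q n := by
    have := (hpos n).dotProduct_mulVec_nonneg
      fun y => Complex.exp (-(Complex.I * (y.1 : ℕ) * ω)) * x y.2
    simpa only [dotProduct_blockToeplitz_mulVec_exp, Q, Finset.sum_range] using this
  have hform : star x ⬝ᵥ (blockSymbol H r ω *ᵥ x) = ∑ d ∈ Finset.Icc (-(r : ℤ)) r, φ d := by
    simp only [blockSymbol, sum_mulVec, dotProduct_sum, smul_mulVec, dotProduct_smul, smul_eq_mul,
      φ]
  have hstep (n : ℕ) (hn : r ≤ n) : Q (n + 1) = Q n + star x ⬝ᵥ (blockSymbol H r ω *ᵥ x) := by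
    rw [hform, Finset.sum_subset (Finset.Icc_subset_Icc (neg_le_neg (Int.ofNat_le.2 hn))
      (Int.ofNat_le.2 hn)) fun d _ hd => ?_]
    · exact sum_sum_sub_range_succ φ n
    · rw [Finset.mem_Icc, ← abs_le, not_le] at hd
      simp [φ, hr d hd]
  have hQr (n : ℕ) : Q (r + n) = Q r + n * (star x ⬝ᵥ (blockSymbol H r ω *ᵥ x)) := by
    induction n with
    | zero => simp
    | succ n ih =>
      rw [← add_assoc, hstep _ (Nat.le_add_right r n), ih]
      push_cast
      ring
  refine Complex.nonneg_iff.2 ⟨le_of_not_gt fun hneg => ?_,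
    ((isHermitian_blockSymbol hH ω).im_star_dotProduct_mulVec_self x).symm⟩
  obtain ⟨n, hn⟩ := exists_nat_gt ((Q r).re / -(star x ⬝ᵥ (blockSymbol H r ω *ᵥ x)).re)
  rw [div_lt_iff₀ (neg_pos.2 hneg)] at hn
  have := (Complex.nonneg_iff.1 (hQ (r + n))).1
  rw [hQr, Complex.add_re, Complex.mul_re, Complex.natCast_re, Complex.natCast_im, zero_mul,
    sub_zero] at this
  linarith

end Symbol

section BlockDiagonal

open Matrix
open scoped ComplexOrder

lemma posSemidef_blockDiagonal {R m k : Type*} [Finite m] [Finite k] [DecidableEq k]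
    [Ring R] [PartialOrder R] [StarRing R] [AddLeftMono R] {M : k → Matrix m m R}
    (hM : ∀ j, (M j).PosSemidef) : (blockDiagonal M).PosSemidef := by
  have := Fintype.ofFinite m
  have := Fintype.ofFinite k
  refine PosSemidef.of_dotProduct_mulVec_nonneg ?_ fun x => ?_
  · rw [IsHermitian, blockDiagonal_conjTranspose]
    exact congrArg blockDiagonal (funext fun j => (hM j).isHermitian)
  · have hsplit : star x ⬝ᵥ (blockDiagonal M *ᵥ x) =
        ∑ j, star (fun i => x (i, j)) ⬝ᵥ (M j *ᵥ fun i => x (i, j)) := by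
      simp only [dotProduct, mulVec, Fintype.sum_prod_type, blockDiagonal_apply, ite_mul, zero_mul,
        Finset.sum_ite_eq, Finset.mem_univ, if_true, Pi.star_apply]
      exact Finset.sum_comm
    rw [hsplit]
    exact Finset.sum_nonneg fun j _ => (hM j).dotProduct_mulVec_nonneg _

variable {m k : Type*} [Fintype m] [DecidableEq m] [Fintype k] [DecidableEq k]

lemma logDetOneAdd_blockDiagonal {M : k → Matrix m m ℂ} (hM : ∀ j, (M j).PosSemidef) :
    logDetOneAdd (blockDiagonal M) = ∑ j, logDetOneAdd (M j) := by
  have hdet : (1 + blockDiagonal M).det = (∏ j, (1 + M j).det.re : ℝ) := by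
    rw [← blockDiagonal_one, ← blockDiagonal_add, det_blockDiagonal]
    push_cast
    exact Finset.prod_congr rfl fun j _ => (ofReal_re_det_one_add (hM j)).symm
  rw [logDetOneAdd, hdet, Complex.ofReal_re,
    Real.log_prod fun j _ => (one_pos.trans_le (one_le_re_det_one_add (hM j))).ne']
  rfl

lemma logDetOneAdd_conj_unitary {W : Matrix m m ℂ} (hW : W ∈ unitaryGroup m ℂ)
    (H : Matrix m m ℂ) : logDetOneAdd (W * H * Wᴴ) = logDetOneAdd H := by
  have hWW : W * Wᴴ = 1 := mem_unitaryGroup_iff.1 hW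
  have hconj : 1 + W * H * Wᴴ = W * (1 + H) * Wᴴ := by
    rw [mul_add, add_mul, mul_one, hWW]
  rw [logDetOneAdd, hconj, det_mul_right_comm, hWW, one_mul]
  rfl

end BlockDiagonal

section Circulant

open Matrix
open scoped ComplexOrder Kronecker

lemma sum_exp_mul_dftFrequency {N : ℕ} (hN : N ≠ 0) (m : ℤ) :
    ∑ t : Fin N, Complex.exp (Complex.I * m * (2 * Real.pi * t / N : ℝ)) =
      if (N : ℤ) ∣ m then (N : ℂ) else 0 := by
  have hζ := Complex.isPrimitiveRoot_exp N hN
  set ζ := Complex.exp (2 * Real.pi * Complex.I / N) with hζdef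
  have hterm (t : Fin N) :
      Complex.exp (Complex.I * m * (2 * Real.pi * t / N : ℝ)) = (ζ ^ m) ^ (t : ℕ) := by
    rw [hζdef, ← Complex.exp_int_mul, ← Complex.exp_nat_mul]
    congr 1
    push_cast
    ring
  simp only [hterm, Fin.sum_univ_eq_sum_range (fun t => (ζ ^ m) ^ t)]
  split_ifs with hm <;> rw [← hζ.zpow_eq_one_iff_dvd] at hm
  · simp [hm]
  · rw [geom_sum_eq hm, ← zpow_natCast, ← _root_.zpow_mul, mul_comm, _root_.zpow_mul, zpow_natCast,
      hζ.pow_eq_one]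
    simp

/-- The discrete Fourier transform on `N` points, as a unitary matrix. -/
noncomputable def dftMatrix (N : ℕ) : Matrix (Fin N) (Fin N) ℂ :=
  of fun k t => ((√N)⁻¹ : ℝ) * Complex.exp (-(Complex.I * k * (2 * Real.pi * t / N : ℝ)))

lemma dftMatrix_mul_conj {N : ℕ} (k l t : Fin N) :
    dftMatrix N k t * star (dftMatrix N l t) =
      (N : ℂ)⁻¹ * Complex.exp (Complex.I * (l - k : ℤ) * (2 * Real.pi * t / N : ℝ)) := by
  have hsqrt : (((√N)⁻¹ : ℝ) : ℂ) * ((√N)⁻¹ : ℝ) = (N : ℂ)⁻¹ := by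
    rw [← Complex.ofReal_mul, ← mul_inv, Real.mul_self_sqrt N.cast_nonneg]
    simp
  simp only [dftMatrix, of_apply, star_mul', Complex.star_def, Complex.conj_ofReal,
    ← Complex.exp_conj]
  rw [mul_mul_mul_comm, hsqrt, ← Complex.exp_add]
  congr 2
  simp only [map_neg, map_mul, Complex.conj_I, Complex.conj_ofReal, map_natCast]
  push_cast
  ring

lemma dftMatrix_mem_unitaryGroup (N : ℕ) : dftMatrix N ∈ unitaryGroup (Fin N) ℂ := by
  rw [mem_unitaryGroup_iff]
  ext k l
  have hN : N ≠ 0 := k.pos.ne'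
  have hdvd : (N : ℤ) ∣ (l : ℤ) - k ↔ k = l := by
    rw [Fin.ext_iff]
    refine ⟨fun h => ?_, fun h => by simp [h]⟩
    have := Int.eq_zero_of_abs_lt_dvd h (by rw [abs_lt]; omega)
    omega
  simp only [mul_apply, star_apply, dftMatrix_mul_conj, ← Finset.mul_sum,
    sum_exp_mul_dftFrequency hN, hdvd, one_apply]
  split_ifs <;> simp [hN]

variable {q : Type*} [Fintype q] [DecidableEq q] {H : ℤ → Matrix q q ℂ} {r N : ℕ}

/-- The block circulant matrix built from the taps `H d`, `|d| ≤ r`, given by its block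
diagonalization: the discrete Fourier transform conjugates it into the diagonal of the samples of
the symbol at the `N`-th roots of unity. -/
noncomputable def blockCirculant (H : ℤ → Matrix q q ℂ) (r N : ℕ) :
    Matrix (q × Fin N) (q × Fin N) ℂ :=
  ((1 : Matrix q q ℂ) ⊗ₖ dftMatrix N) *
    blockDiagonal (fun t : Fin N => blockSymbol H r (2 * Real.pi * t / N)) *
    ((1 : Matrix q q ℂ) ⊗ₖ dftMatrix N)ᴴ

lemma posSemidef_blockCirculant (hpos : ∀ ω, (blockSymbol H r ω).PosSemidef) :
    (blockCirculant H r N).PosSemidef :=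
  (posSemidef_blockDiagonal fun _ => hpos _).mul_mul_conjTranspose_same _

lemma logDetOneAdd_smul_blockCirculant (hpos : ∀ ω, (blockSymbol H r ω).PosSemidef) {γ : ℝ}
    (hγ : 0 ≤ γ) :
    logDetOneAdd ((γ : ℂ) • blockCirculant H r N) =
      ∑ t ∈ Finset.range N, logDetOneAdd ((γ : ℂ) • blockSymbol H r (2 * Real.pi * t / N)) := by
  have hγ' : (0 : ℂ) ≤ γ := by exact_mod_cast hγ
  rw [blockCirculant, ← smul_mul_assoc, ← mul_smul_comm, logDetOneAdd_conj_unitary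
    (kronecker_mem_unitary (one_mem _) (dftMatrix_mem_unitaryGroup N)), ← blockDiagonal_smul,
    Finset.sum_range]
  exact logDetOneAdd_blockDiagonal fun _ => (hpos _).smul hγ'

lemma blockCirculant_apply_eq_sum (i j : q) (k l : Fin N) :
    blockCirculant H r N (i, k) (j, l) =
      ∑ d ∈ Finset.Icc (-(r : ℤ)) r, if (N : ℤ) ∣ d - (k - l) then H d i j else 0 := by
  have hN : N ≠ 0 := k.pos.ne'
  have hentry : blockCirculant H r N (i, k) (j, l) = ∑ t : Fin N,
      dftMatrix N k t * star (dftMatrix N l t) * blockSymbol H r (2 * Real.pi * t / N) i j := by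
    simp only [blockCirculant, mul_apply, Fintype.sum_prod_type, kroneckerMap_apply, one_apply,
      conjTranspose_apply, blockDiagonal_apply, ite_mul, mul_ite, one_mul, zero_mul, mul_zero,
      Finset.sum_ite_eq, Finset.sum_ite_eq', Finset.mem_univ, if_true]
    rw [Finset.sum_comm]
    simp only [apply_ite star, star_zero, mul_ite, mul_zero, Finset.sum_ite_eq, Finset.mem_univ,
      if_true]
    exact Finset.sum_congr rfl fun t _ => mul_right_comm _ _ _
  simp only [hentry, dftMatrix_mul_conj, blockSymbol_apply, Finset.mul_sum]
  rw [Finset.sum_comm]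
  refine Finset.sum_congr rfl fun d _ => ?_
  have hphase (t : Fin N) : (N : ℂ)⁻¹ *
      Complex.exp (Complex.I * (l - k : ℤ) * (2 * Real.pi * t / N : ℝ)) *
      (Complex.exp (Complex.I * d * (2 * Real.pi * t / N : ℝ)) * H d i j) =
      (N : ℂ)⁻¹ * H d i j *
        Complex.exp (Complex.I * (d - (k - l) : ℤ) * (2 * Real.pi * t / N : ℝ)) := by
    have hadd (ω : ℂ) : Complex.exp (Complex.I * (d - (k - l) : ℤ) * ω) =
        Complex.exp (Complex.I * (l - k : ℤ) * ω) * Complex.exp (Complex.I * d * ω) := by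
      rw [← Complex.exp_add]
      congr 1
      push_cast
      ring
    rw [hadd]
    ring
  simp only [hphase, ← Finset.mul_sum, sum_exp_mul_dftFrequency hN, mul_ite, mul_zero]
  rw [mul_right_comm, inv_mul_cancel₀ (Nat.cast_ne_zero.2 hN), one_mul]

lemma blockCirculant_apply (hr : ∀ d : ℤ, r < |d| → H d = 0) (i j : q) {k l : Fin N}
    (hkl : |(k : ℤ) - l| + r < N) : blockCirculant H r N (i, k) (j, l) = H (k - l) i j := by
  rw [blockCirculant_apply_eq_sum]
  have hdvd {d : ℤ} (hd : d ∈ Finset.Icc (-(r : ℤ)) r) :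
      (N : ℤ) ∣ d - (k - l) ↔ d = k - l := by
    refine ⟨fun h => ?_, fun h => by simp [h]⟩
    rw [Finset.mem_Icc, ← abs_le] at hd
    exact sub_eq_zero.1 (Int.eq_zero_of_abs_lt_dvd h (by have := abs_sub d (k - l : ℤ); omega))
  rw [Finset.sum_congr rfl fun d hd => if_congr (hdvd hd) rfl rfl, Finset.sum_ite_eq']
  split_ifs with hmem
  · rfl
  · rw [Finset.mem_Icc, ← abs_le, not_le] at hmem
    rw [hr _ hmem, Matrix.zero_apply]

end Circulant

section Szego

open Matrix Filter Topology
open scoped ComplexOrder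

variable {q : Type*} [Fintype q] [DecidableEq q] {H : ℤ → Matrix q q ℂ} {r : ℕ}

/- Inside a circulant matrix with `r + 1` more block rows, the Toeplitz matrix is a principal
submatrix, and the complementary diagonal block has a diagonal that does not depend on `n`. -/
lemma exists_abs_logDetOneAdd_blockToeplitz_sub_blockCirculant_le
    (hr : ∀ d : ℤ, r < |d| → H d = 0) (hpos : ∀ ω, (blockSymbol H r ω).PosSemidef) {γ : ℝ}
    (hγ : 0 ≤ γ) :
    ∃ M, ∀ n, |logDetOneAdd ((γ : ℂ) • blockToeplitz H n) -
      logDetOneAdd ((γ : ℂ) • blockCirculant H r (n + (r + 1)))| ≤ M := by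
  refine ⟨Fintype.card (Fin (r + 1) × q) *
    Real.log (∑ x : Fin (r + 1) × q, (1 + γ * H 0 x.2 x.2)).re, fun n => ?_⟩
  let e : (Fin n × q) ⊕ (Fin (r + 1) × q) ≃ q × Fin (n + (r + 1)) :=
    (Equiv.sumProdDistrib _ _ _).symm.trans
      ((Equiv.prodCongr finSumFinEquiv (Equiv.refl q)).trans (Equiv.prodComm _ _))
  let X := ((γ : ℂ) • blockCirculant H r (n + (r + 1))).submatrix e e
  have hγ' : (0 : ℂ) ≤ γ := by exact_mod_cast hγ
  have hX : X.PosSemidef := ((posSemidef_blockCirculant hpos).smul hγ').submatrix e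
  have hToeplitz : X.toBlocks₁₁ = (γ : ℂ) • blockToeplitz H n := by
    ext ⟨k, i⟩ ⟨l, j⟩
    refine congrArg ((γ : ℂ) * ·) (blockCirculant_apply hr i j ?_)
    have hkl : |((k : ℕ) : ℤ) - (l : ℕ)| < n := by rw [abs_lt]; omega
    push_cast
    exact add_lt_add hkl (lt_add_one _)
  have htrace : (1 + X.toBlocks₂₂).trace = ∑ x : Fin (r + 1) × q, (1 + γ * H 0 x.2 x.2) := by
    refine Finset.sum_congr rfl fun x _ => ?_
    have : X.toBlocks₂₂ x x = γ * H 0 x.2 x.2 := by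
      refine congrArg ((γ : ℂ) * ·) ?_
      rw [← sub_self ((e (Sum.inr x)).2 : ℤ)]
      refine blockCirculant_apply hr _ _ ?_
      rw [sub_self, abs_zero]
      omega
    rw [diag_apply, Matrix.add_apply, one_apply_eq, this]
  have hblocks : X = fromBlocks X.toBlocks₁₁ X.toBlocks₁₂ X.toBlocks₁₂ᴴ X.toBlocks₂₂ := by
    have hsymm : X.toBlocks₁₂ᴴ = X.toBlocks₂₁ := by
      ext x y
      exact hX.isHermitian.apply _ _
    rw [hsymm, fromBlocks_toBlocks]
  rw [← logDetOneAdd_reindex e, ← hToeplitz, ← htrace]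
  have := abs_logDetOneAdd_sub_fromBlocks_le (hblocks ▸ hX)
  rwa [← hblocks] at this

lemma tendsto_logDetOneAdd_blockToeplitz (hr : ∀ d : ℤ, r < |d| → H d = 0)
    (hpos : ∀ ω, (blockSymbol H r ω).PosSemidef) {γ : ℝ} (hγ : 0 ≤ γ) :
    Tendsto (fun n : ℕ => 1 / (n : ℝ) * logDetOneAdd ((γ : ℂ) • blockToeplitz H n)) atTop
      (𝓝 (1 / (2 * Real.pi) *
        ∫ ω in (-Real.pi)..Real.pi, logDetOneAdd ((γ : ℂ) • blockSymbol H r ω))) := by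
  let g : ℝ → ℝ := fun ω => logDetOneAdd ((γ : ℂ) • blockSymbol H r ω)
  have hγ' : (0 : ℂ) ≤ γ := by exact_mod_cast hγ
  have hcont : Continuous g :=
    continuous_logDetOneAdd (f := (γ : ℂ) • blockSymbol H r) (continuous_blockSymbol.const_smul _)
      fun ω => (hpos ω).smul hγ'
  have hperiod : Function.Periodic g (2 * Real.pi) :=
    periodic_blockSymbol.comp fun S => logDetOneAdd ((γ : ℂ) • S)
  have hshift : ∫ ω in (0 : ℝ)..(2 * Real.pi), g ω = ∫ ω in (-Real.pi)..Real.pi, g ω := by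
    have := hperiod.intervalIntegral_add_eq 0 (-Real.pi)
    rwa [zero_add, neg_add_eq_sub, two_mul, add_sub_cancel_right, ← two_mul] at this
  have hcirc : Tendsto (fun N : ℕ => 1 / (N : ℝ) * logDetOneAdd ((γ : ℂ) • blockCirculant H r N))
      atTop (𝓝 (1 / (2 * Real.pi) * ∫ ω in (-Real.pi)..Real.pi, g ω)) := by
    rw [← hshift]
    refine ((tendsto_riemannSum Real.two_pi_pos hcont.continuousOn).const_mul _).congr fun N => ?_
    rw [logDetOneAdd_smul_blockCirculant hpos hγ, smul_eq_mul]
    field_simp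
    rfl
  obtain ⟨M, hM⟩ := exists_abs_logDetOneAdd_blockToeplitz_sub_blockCirculant_le hr hpos hγ
  exact tendsto_inv_mul_of_abs_sub_shift_le hcirc hM

end Szego

section KullbackLeibler

open InformationTheory

variable {α β : Type*} [MeasurableSpace α] [MeasurableSpace β]

lemma klDiv_map_of_leftInverse {μ ν : Measure α} [IsFiniteMeasure μ] [IsFiniteMeasure ν]
    {f : α → β} {g : β → α} (hf : Measurable f) (hg : Measurable g)
    (hgf : Function.LeftInverse g f) : klDiv (μ.map f) (ν.map f) = klDiv μ ν := by
  refine le_antisymm (klDiv_map_le μ ν hf) ?_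
  have h := klDiv_map_le (μ.map f) (ν.map f) hg
  rwa [Measure.map_map hg hf, Measure.map_map hg hf, hgf.comp_eq_id, Measure.map_id,
    Measure.map_id] at h

lemma klDiv_prod (μ₁ ν₁ : Measure α) (μ₂ ν₂ : Measure β) [IsProbabilityMeasure μ₁]
    [IsProbabilityMeasure ν₁] [IsProbabilityMeasure μ₂] [IsProbabilityMeasure ν₂] :
    klDiv (μ₁.prod μ₂) (ν₁.prod ν₂) = klDiv μ₁ ν₁ + klDiv μ₂ ν₂ := by
  have hswap : klDiv (μ₁.prod μ₂) (μ₁.prod ν₂) = klDiv μ₂ ν₂ := by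
    rw [← klDiv_compProd_left μ₂ ν₂ (Kernel.const β μ₁), Measure.compProd_const,
      Measure.compProd_const, ← Measure.prod_swap, ← Measure.prod_swap (μ := ν₂)]
    exact klDiv_map_of_leftInverse measurable_swap measurable_swap Prod.swap_swap
  rw [← hswap, ← Measure.compProd_const, ← Measure.compProd_const, ← Measure.compProd_const]
  exact klDiv_compProd_eq_add _ _ _ _

lemma klDiv_pi {ι : Type*} [Fintype ι] (μ ν : ι → Measure α) [∀ i, IsProbabilityMeasure (μ i)]
    [∀ i, IsProbabilityMeasure (ν i)] :
    klDiv (Measure.pi μ) (Measure.pi ν) = ∑ i, klDiv (μ i) (ν i) := by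
  revert μ ν
  refine Fintype.induction_empty_option (P := fun ι _ => ∀ (μ ν : ι → Measure α)
    [∀ i, IsProbabilityMeasure (μ i)] [∀ i, IsProbabilityMeasure (ν i)],
    klDiv (Measure.pi μ) (Measure.pi ν) = ∑ i, klDiv (μ i) (ν i)) ?of_equiv ?empty ?option ι
  case of_equiv =>
    intro ι κ _ e ih μ ν _ _
    let := Fintype.ofEquiv κ e.symm
    rw [← Measure.pi_map_piCongrLeft e μ, ← Measure.pi_map_piCongrLeft e ν,
      klDiv_map_of_leftInverse (MeasurableEquiv.measurable _)
        (MeasurableEquiv.piCongrLeft (fun _ : κ => α) e).symm.measurable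
        (MeasurableEquiv.piCongrLeft (fun _ : κ => α) e).symm_apply_apply,
      ih, e.sum_comp fun i => klDiv (μ i) (ν i)]
  case empty =>
    intro μ ν _ _
    rw [Measure.pi_of_empty, Measure.pi_of_empty, klDiv_self, Finset.sum_of_isEmpty]
  case option =>
    intro ι _ ih μ ν _ _
    rw [← Measure.pi_map_piOptionEquivProd μ, ← Measure.pi_map_piOptionEquivProd ν,
      klDiv_map_of_leftInverse (MeasurableEquiv.measurable _)
        (MeasurableEquiv.piOptionEquivProd (fun _ : Option ι => α)).measurable
        (MeasurableEquiv.piOptionEquivProd (fun _ : Option ι => α)).apply_symm_apply,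
      klDiv_prod, ih, Fintype.sum_option, add_comm]

lemma klDiv_withDensity_ofReal {ν : Measure α} [IsProbabilityMeasure ν] {f : α → ℝ}
    [IsProbabilityMeasure (ν.withDensity fun x => ENNReal.ofReal (f x))] (hf : Measurable f)
    (hpos : ∀ x, 0 < f x)
    (hint : Integrable (fun x => Real.log (f x)) (ν.withDensity fun x => ENNReal.ofReal (f x))) :
    klDiv (ν.withDensity fun x => ENNReal.ofReal (f x)) ν =
      ENNReal.ofReal (∫ x, Real.log (f x) ∂ν.withDensity fun x => ENNReal.ofReal (f x)) := by
  set μ := ν.withDensity fun x => ENNReal.ofReal (f x)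
  have hac : μ ≪ ν := withDensity_absolutelyContinuous _ _
  have hllr : llr μ ν =ᵐ[μ] fun x => Real.log (f x) := by
    filter_upwards [hac.ae_le (Measure.rnDeriv_withDensity ν hf.ennreal_ofReal)] with x hx
    rw [llr, hx, ENNReal.toReal_ofReal (hpos x).le]
  rw [klDiv_of_ac_of_integrable hac (hint.congr hllr.symm), integral_congr_ae hllr]
  simp only [probReal_univ, add_sub_cancel_right]

end KullbackLeibler

section MutualInfo

open InformationTheory

variable {Ω E F : Type*} [MeasurableSpace Ω] [MeasurableSpace E] [MeasurableSpace F]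
  {P : Measure Ω} [IsProbabilityMeasure P]

lemma mutualInfo_comp_of_leftInverse {E' F' : Type*} [MeasurableSpace E'] [MeasurableSpace F']
    {X : Ω → E} {Y : Ω → F} (hX : AEMeasurable X P) (hY : AEMeasurable Y P)
    {f : E → E'} {f' : E' → E} {g : F → F'} {g' : F' → F}
    (hf : Measurable f) (hf' : Measurable f') (hg : Measurable g) (hg' : Measurable g')
    (hff' : Function.LeftInverse f' f) (hgg' : Function.LeftInverse g' g) :
    mutualInfo P (fun w => f (X w)) (fun w => g (Y w)) = mutualInfo P X Y := by
  have := Measure.isProbabilityMeasure_map hX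
  have := Measure.isProbabilityMeasure_map hY
  have := Measure.isProbabilityMeasure_map (hX.prodMk hY)
  have hjoint : P.map (fun w => (f (X w), g (Y w))) =
      (P.map fun w => (X w, Y w)).map (Prod.map f g) :=
    (AEMeasurable.map_map_of_aemeasurable (hf.prodMap hg).aemeasurable (hX.prodMk hY)).symm
  have hprod : (P.map fun w => f (X w)).prod (P.map fun w => g (Y w)) =
      ((P.map X).prod (P.map Y)).map (Prod.map f g) := by
    rw [← Measure.map_prod_map _ _ hf hg, AEMeasurable.map_map_of_aemeasurable hf.aemeasurable hX,
      AEMeasurable.map_map_of_aemeasurable hg.aemeasurable hY]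
    rfl
  rw [mutualInfo, hjoint, hprod, klDiv_map_of_leftInverse (hf.prodMap hg) (hf'.prodMap hg')
    (hff'.prodMap hgg'), mutualInfo]

lemma mutualInfo_eq_zero_of_indepFun {X : Ω → E} {Y : Ω → F} (hX : AEMeasurable X P)
    (hY : AEMeasurable Y P) (hXY : IndepFun X Y P) : mutualInfo P X Y = 0 := by
  have := Measure.isProbabilityMeasure_map hX
  have := Measure.isProbabilityMeasure_map hY
  rw [mutualInfo, hXY.map_prod_eq_prod_map_map hX hY, klDiv_self]

variable {ι : Type*}

lemma iIndepFun_prodMk [Finite ι] {X : ι → Ω → E} {Y : ι → Ω → F} (hX : ∀ i, AEMeasurable (X i) P)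
    (hY : ∀ i, AEMeasurable (Y i) P) (iX : iIndepFun X P) (iY : iIndepFun Y P)
    (hXY : IndepFun (fun w i => X i w) (fun w i => Y i w) P) :
    iIndepFun (fun i w => (X i w, Y i w)) P := by
  have := Fintype.ofFinite ι
  have : ∀ i, IsProbabilityMeasure (P.map (X i)) := fun i => Measure.isProbabilityMeasure_map (hX i)
  have : ∀ i, IsProbabilityMeasure (P.map (Y i)) := fun i => Measure.isProbabilityMeasure_map (hY i)
  have hpair (i) : P.map (fun w => (X i w, Y i w)) = (P.map (X i)).prod (P.map (Y i)) :=
    (hXY.comp (measurable_pi_apply i) (measurable_pi_apply i)).map_prod_eq_prod_map_map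
      (hX i) (hY i)
  let e := MeasurableEquiv.arrowProdEquivProdArrow E F ι
  have he := measurePreserving_arrowProdEquivProdArrow E F ι (fun i => P.map (X i))
    fun i => P.map (Y i)
  rw [iIndepFun_iff_map_fun_eq_pi_map fun i => (hX i).prodMk (hY i)]
  simp only [hpair]
  rw [← he.symm.map_eq, ← iX.map_fun_eq_pi_map hX, ← iY.map_fun_eq_pi_map hY,
    ← hXY.map_prod_eq_prod_map_map (by fun_prop) (by fun_prop),
    AEMeasurable.map_map_of_aemeasurable e.symm.measurable.aemeasurable (by fun_prop)]
  rfl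

lemma mutualInfo_pi [Fintype ι] {X : ι → Ω → E} {Y : ι → Ω → F} (hX : ∀ i, AEMeasurable (X i) P)
    (hY : ∀ i, AEMeasurable (Y i) P) (hXY : iIndepFun (fun i w => (X i w, Y i w)) P) :
    mutualInfo P (fun w i => X i w) (fun w i => Y i w) = ∑ i, mutualInfo P (X i) (Y i) := by
  have : ∀ i, IsProbabilityMeasure (P.map (X i)) := fun i => Measure.isProbabilityMeasure_map (hX i)
  have : ∀ i, IsProbabilityMeasure (P.map (Y i)) := fun i => Measure.isProbabilityMeasure_map (hY i)
  have : ∀ i, IsProbabilityMeasure (P.map fun w => (X i w, Y i w)) := fun i =>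
    Measure.isProbabilityMeasure_map ((hX i).prodMk (hY i))
  let e := MeasurableEquiv.arrowProdEquivProdArrow E F ι
  have hjoint : P.map (fun w => (fun i => X i w, fun i => Y i w)) =
      (Measure.pi fun i => P.map fun w => (X i w, Y i w)).map e := by
    rw [← hXY.map_fun_eq_pi_map fun i => (hX i).prodMk (hY i),
      AEMeasurable.map_map_of_aemeasurable e.measurable.aemeasurable
        (aemeasurable_pi_lambda _ fun i => (hX i).prodMk (hY i))]
    rfl
  have hprod : (P.map fun w i => X i w).prod (P.map fun w i => Y i w) =
      (Measure.pi fun i => (P.map (X i)).prod (P.map (Y i))).map e := by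
    rw [(hXY.comp _ fun _ => measurable_fst).map_fun_eq_pi_map hX,
      (hXY.comp _ fun _ => measurable_snd).map_fun_eq_pi_map hY]
    exact (measurePreserving_arrowProdEquivProdArrow E F ι _ _).map_eq.symm
  rw [mutualInfo, hjoint, hprod,
    klDiv_map_of_leftInverse e.measurable e.symm.measurable e.symm_apply_apply, klDiv_pi]
  rfl

end MutualInfo

section ScalarGaussianChannel

open InformationTheory
open scoped NNReal

/-- The variance of the output `c B + Z` of a scalar channel whose input `B` and noise `Z` are
independent of variances `p` and `v`. -/
noncomputable def outputVariance (c : ℝ) (p v : ℝ≥0) : ℝ≥0 := .mk (c ^ 2) (sq_nonneg c) * p + v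

/-- The density of the law of `(c B + Z, B)`, for independent centred Gaussians `B` and `Z` of
variances `p` and `v`, with respect to the product of its marginals. -/
noncomputable def gaussianRatio (c : ℝ) (p v : ℝ≥0) (x : ℝ × ℝ) : ℝ :=
  gaussianPDFReal (c * x.2) v x.1 / gaussianPDFReal 0 (outputVariance c p v) x.1

variable (c : ℝ) (p : ℝ≥0) {v : ℝ≥0}

lemma outputVariance_ne_zero (hv : v ≠ 0) : outputVariance c p v ≠ 0 := by
  simp [outputVariance, hv]

lemma measurable_gaussianRatio (v : ℝ≥0) : Measurable (gaussianRatio c p v) := by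
  unfold gaussianRatio
  simp only [gaussianPDFReal]
  fun_prop

lemma gaussianRatio_pos (hv : v ≠ 0) (x : ℝ × ℝ) : 0 < gaussianRatio c p v x :=
  div_pos (gaussianPDFReal_pos _ _ _ hv)
    (gaussianPDFReal_pos _ _ _ (outputVariance_ne_zero c p hv))

lemma log_gaussianRatio (hv : v ≠ 0) (x : ℝ × ℝ) :
    Real.log (gaussianRatio c p v x) =
      1 / 2 * Real.log (outputVariance c p v / v) - (x.1 - c * x.2) ^ 2 / (2 * v) +
        x.1 ^ 2 / (2 * outputVariance c p v) := by
  have hs := outputVariance_ne_zero c p hv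
  have hs' : (0 : ℝ) < outputVariance c p v := by positivity
  have hv' : (0 : ℝ) < v := by positivity
  rw [gaussianRatio, Real.log_div (gaussianPDFReal_pos _ _ _ hv).ne'
    (gaussianPDFReal_pos _ _ _ hs).ne', gaussianPDFReal, gaussianPDFReal,
    Real.log_mul (by positivity) (by positivity), Real.log_mul (by positivity) (by positivity),
    Real.log_exp, Real.log_exp, Real.log_inv, Real.log_inv, Real.log_sqrt (by positivity),
    Real.log_sqrt (by positivity), Real.log_mul (by positivity) hv'.ne',
    Real.log_mul (by positivity) hs'.ne', Real.log_div hs'.ne' hv'.ne']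
  ring

lemma map_gaussianReal_prod_eq_withDensity (hv : v ≠ 0) :
    ((gaussianReal 0 p).prod (gaussianReal 0 v)).map (fun x => (c * x.1 + x.2, x.1)) =
      ((gaussianReal 0 (outputVariance c p v)).prod (gaussianReal 0 p)).withDensity
        fun x => ENNReal.ofReal (gaussianRatio c p v x) := by
  have hs := outputVariance_ne_zero c p hv
  refine Measure.ext_of_lintegral _ fun g hg => ?_
  rw [lintegral_withDensity_eq_lintegral_mul _ (measurable_gaussianRatio c p v).ennreal_ofReal hg,
    lintegral_map hg (by fun_prop), lintegral_prod _ (by fun_prop),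
    lintegral_prod_symm _ (by
      have := (measurable_gaussianRatio c p v).ennreal_ofReal
      fun_prop)]
  refine lintegral_congr fun b => ?_
  have hcond : gaussianReal (c * b) v = (gaussianReal 0 v).map (c * b + ·) := by
    rw [gaussianReal_map_const_add, zero_add]
  have houtput : ∫⁻ z, g (c * b + z, b) ∂gaussianReal 0 v =
      ∫⁻ y, g (y, b) ∂gaussianReal (c * b) v := by
    rw [hcond, lintegral_map (by fun_prop) (by fun_prop)]
  rw [houtput, gaussianReal_of_var_ne_zero _ hv, gaussianReal_of_var_ne_zero _ hs,
    lintegral_withDensity_eq_lintegral_mul _ (measurable_gaussianPDF _ _) (by fun_prop),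
    lintegral_withDensity_eq_lintegral_mul _ (measurable_gaussianPDF _ _) (by
      have := (measurable_gaussianRatio c p v).ennreal_ofReal
      fun_prop)]
  refine lintegral_congr fun y => ?_
  simp only [Pi.mul_apply]
  rw [← mul_assoc, gaussianPDF, gaussianPDF, ← ENNReal.ofReal_mul (gaussianPDFReal_nonneg _ _ _),
    gaussianRatio, mul_div_cancel₀ _ (gaussianPDFReal_pos _ _ _ hs).ne']

variable {Ω : Type*} [MeasurableSpace Ω] {P : Measure Ω} {B Z : Ω → ℝ}

lemma integrable_sq_of_hasLaw_gaussianReal (hZ : HasLaw Z (gaussianReal 0 v) P) :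
    Integrable (fun w => Z w ^ 2) P := by
  have h := (memLp_id_gaussianReal' (μ := 0) (v := v) 2 (by simp)).integrable_sq
  rw [← hZ.map_eq] at h
  exact h.comp_aemeasurable hZ.aemeasurable

lemma integral_sq_of_hasLaw_gaussianReal (hZ : HasLaw Z (gaussianReal 0 v) P) :
    ∫ w, Z w ^ 2 ∂P = v := by
  have hmean : ∫ w, Z w ∂P = 0 := by rw [hZ.integral_eq, integral_id_gaussianReal]
  rw [← variance_of_integral_eq_zero hZ.aemeasurable hmean, hZ.variance_eq,
    variance_id_gaussianReal]

lemma hasLaw_const_mul_add (hB : HasLaw B (gaussianReal 0 p) P)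
    (hZ : HasLaw Z (gaussianReal 0 v) P) (hBZ : IndepFun B Z P) :
    HasLaw (fun w => c * B w + Z w) (gaussianReal 0 (outputVariance c p v)) P where
  aemeasurable := (hB.aemeasurable.const_mul c).add hZ.aemeasurable
  map_eq := by
    have hcB := gaussianReal_const_mul hB c
    rw [mul_zero] at hcB
    have h := gaussianReal_add_gaussianReal_of_indepFun
      (hBZ.comp (measurable_const_mul c) measurable_id) hcB.map_eq hZ.map_eq
    rwa [add_zero] at h

lemma outputVariance_div (hv : v ≠ 0) :
    (outputVariance c p v : ℝ) / v = 1 + c ^ 2 * p / v := by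
  have hv' : (v : ℝ) ≠ 0 := by exact_mod_cast hv
  simp only [outputVariance, NNReal.coe_add, NNReal.coe_mul, NNReal.coe_mk]
  field_simp
  ring

lemma map_prodMk_eq_withDensity_gaussianRatio (hB : HasLaw B (gaussianReal 0 p) P)
    (hZ : HasLaw Z (gaussianReal 0 v) P) (hBZ : IndepFun B Z P) (hv : v ≠ 0) :
    P.map (fun w => (c * B w + Z w, B w)) =
      ((gaussianReal 0 (outputVariance c p v)).prod (gaussianReal 0 p)).withDensity
        fun x => ENNReal.ofReal (gaussianRatio c p v x) := by
  have := hB.isProbabilityMeasure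
  rw [← map_gaussianReal_prod_eq_withDensity c p hv, ← hB.map_eq, ← hZ.map_eq,
    ← hBZ.map_prod_eq_prod_map_map hB.aemeasurable hZ.aemeasurable,
    AEMeasurable.map_map_of_aemeasurable (by fun_prop) (hB.aemeasurable.prodMk hZ.aemeasurable)]
  rfl

lemma integrable_log_gaussianRatio (hB : HasLaw B (gaussianReal 0 p) P)
    (hZ : HasLaw Z (gaussianReal 0 v) P) (hBZ : IndepFun B Z P) (hv : v ≠ 0) :
    Integrable (fun w => Real.log (gaussianRatio c p v (c * B w + Z w, B w))) P := by
  have := hB.isProbabilityMeasure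
  simp only [log_gaussianRatio c p hv, add_sub_cancel_left]
  exact ((integrable_const _).sub ((integrable_sq_of_hasLaw_gaussianReal hZ).div_const _)).add
    ((integrable_sq_of_hasLaw_gaussianReal (hasLaw_const_mul_add c p hB hZ hBZ)).div_const _)

lemma integral_log_gaussianRatio (hB : HasLaw B (gaussianReal 0 p) P)
    (hZ : HasLaw Z (gaussianReal 0 v) P) (hBZ : IndepFun B Z P) (hv : v ≠ 0) :
    ∫ w, Real.log (gaussianRatio c p v (c * B w + Z w, B w)) ∂P =
      1 / 2 * Real.log (1 + c ^ 2 * p / v) := by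
  have := hB.isProbabilityMeasure
  have hY := hasLaw_const_mul_add c p hB hZ hBZ
  have iZ := (integrable_sq_of_hasLaw_gaussianReal hZ).div_const (2 * v)
  have iY := (integrable_sq_of_hasLaw_gaussianReal hY).div_const (2 * outputVariance c p v)
  have hv' : (v : ℝ) ≠ 0 := by exact_mod_cast hv
  have hs' : (outputVariance c p v : ℝ) ≠ 0 := by exact_mod_cast outputVariance_ne_zero c p hv
  simp only [log_gaussianRatio c p hv, add_sub_cancel_left]
  rw [integral_add (by fun_prop) iY, integral_sub (by fun_prop) iZ, integral_div, integral_div,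
    integral_sq_of_hasLaw_gaussianReal hZ, integral_sq_of_hasLaw_gaussianReal hY,
    outputVariance_div c p hv, integral_const, probReal_univ, one_smul]
  field_simp
  ring

lemma mutualInfo_gaussian_of_ne_zero (hB : HasLaw B (gaussianReal 0 p) P)
    (hZ : HasLaw Z (gaussianReal 0 v) P) (hBZ : IndepFun B Z P) (hv : v ≠ 0) :
    mutualInfo P (fun w => c * B w + Z w) B =
      ENNReal.ofReal (1 / 2 * Real.log (1 + c ^ 2 * p / v)) := by
  have := hB.isProbabilityMeasure
  have hY := hasLaw_const_mul_add c p hB hZ hBZ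
  have mYB := hY.aemeasurable.prodMk hB.aemeasurable
  have mlog := (measurable_gaussianRatio c p v).log
  have hjoint := map_prodMk_eq_withDensity_gaussianRatio c p hB hZ hBZ hv
  have hprob := Measure.isProbabilityMeasure_map mYB
  rw [hjoint] at hprob
  rw [mutualInfo, hY.map_eq, hB.map_eq, hjoint,
    klDiv_withDensity_ofReal (measurable_gaussianRatio c p v) (gaussianRatio_pos c p hv),
    ← hjoint, integral_map mYB mlog.aestronglyMeasurable,
    integral_log_gaussianRatio c p hB hZ hBZ hv]
  rw [← hjoint, integrable_map_measure mlog.aestronglyMeasurable mYB]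
  exact integrable_log_gaussianRatio c p hB hZ hBZ hv

-- When `v = 0` and `c = 0` the output vanishes, and `0 / 0 = 0` gives the right value.
lemma mutualInfo_gaussian (hB : HasLaw B (gaussianReal 0 p) P)
    (hZ : HasLaw Z (gaussianReal 0 v) P) (hBZ : IndepFun B Z P) (hvc : v = 0 → c = 0) :
    mutualInfo P (fun w => c * B w + Z w) B =
      ENNReal.ofReal (1 / 2 * Real.log (1 + c ^ 2 * p / v)) := by
  have := hB.isProbabilityMeasure
  by_cases hv : v = 0
  · simpa [hv, hvc hv] using
      mutualInfo_eq_zero_of_indepFun hZ.aemeasurable hB.aemeasurable hBZ.symm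
  · exact mutualInfo_gaussian_of_ne_zero c p hB hZ hBZ hv

end ScalarGaussianChannel

section ComplexGaussian

open Matrix
open scoped NNReal ComplexOrder

variable {ι : Type*}

/-- The real parts followed by the imaginary parts of the entries of a complex vector, as a
continuous real-linear map. -/
noncomputable def realCoords : (ι → ℂ) →L[ℝ] (ι ⊕ ι → ℝ) :=
  ContinuousLinearMap.pi (Sum.elim (fun i => Complex.reCLM ∘L ContinuousLinearMap.proj i)
    fun i => Complex.imCLM ∘L ContinuousLinearMap.proj i)

/-- The complex vector with given real and imaginary parts, inverse to `realCoords`. -/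
noncomputable def ofRealCoords (y : ι ⊕ ι → ℝ) (i : ι) : ℂ :=
  y (.inl i) + y (.inr i) * Complex.I

lemma ofRealCoords_realCoords : Function.LeftInverse (ofRealCoords (ι := ι)) realCoords :=
  fun x => funext fun i => Complex.re_add_im (x i)

lemma measurable_ofRealCoords : Measurable (ofRealCoords (ι := ι)) := by
  unfold ofRealCoords
  fun_prop

variable [Fintype ι] {Ω κ : Type*} [MeasurableSpace Ω] {P : Measure Ω}

lemma measurable_mulVec [Finite κ] (A : Matrix κ ι ℂ) :
    Measurable (A *ᵥ · : (ι → ℂ) → κ → ℂ) :=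
  (A.mulVecLin.restrictScalars ℝ).continuous_of_finiteDimensional.measurable

lemma integral_dotProduct_mul_dotProduct {X Y : Ω → ι → ℂ} {M : Matrix ι ι ℂ}
    (hXY : ∀ i j, Integrable (fun w => X w i * Y w j) P)
    (hM : ∀ i j, ∫ w, X w i * Y w j ∂P = M i j) (u v : ι → ℂ) :
    ∫ w, (u ⬝ᵥ X w) * (v ⬝ᵥ Y w) ∂P = u ⬝ᵥ M *ᵥ v := by
  have hterm (i j) : Integrable (fun w => u i * v j * (X w i * Y w j)) P :=
    (hXY i j).const_mul _
  calc ∫ w, (u ⬝ᵥ X w) * (v ⬝ᵥ Y w) ∂P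
      = ∫ w, ∑ i, ∑ j, u i * v j * (X w i * Y w j) ∂P := by
        simp only [dotProduct, Finset.sum_mul_sum, mul_mul_mul_comm]
    _ = ∑ i, ∑ j, u i * v j * M i j := by
        rw [integral_finsetSum _ fun i _ => integrable_finsetSum _ fun j _ => hterm i j]
        simp only [integral_finsetSum _ fun j _ => hterm _ j, integral_const_mul, hM]
    _ = u ⬝ᵥ M *ᵥ v := by
        simp only [dotProduct, Matrix.mulVec, Finset.mul_sum]
        exact Finset.sum_congr rfl fun i _ => Finset.sum_congr rfl fun j _ => by ring

namespace IsProperComplexGaussian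

variable {X : Ω → ι → ℂ} {S : Matrix ι ι ℂ}

lemma memLp_eval (hX : IsProperComplexGaussian P X S) (i : ι) : MemLp (fun w => X w i) 2 P :=
  memLp_pi_iff.1 hX.gaussian.memLp_two i

lemma integrable_eval (hX : IsProperComplexGaussian P X S) (i : ι) :
    Integrable (fun w => X w i) P :=
  have := hX.gaussian.isProbabilityMeasure
  (hX.memLp_eval i).integrable (by norm_num)

lemma integrable_mul (hX : IsProperComplexGaussian P X S) (i j : ι) :
    Integrable (fun w => X w i * X w j) P :=
  (hX.memLp_eval i).integrable_mul (hX.memLp_eval j)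

lemma integrable_mul_conj (hX : IsProperComplexGaussian P X S) (i j : ι) :
    Integrable (fun w => X w i * starRingEnd ℂ (X w j)) P :=
  (hX.memLp_eval i).integrable_mul (hX.memLp_eval j).star

lemma mulVec [Fintype κ] (hX : IsProperComplexGaussian P X S) (A : Matrix κ ι ℂ) :
    IsProperComplexGaussian P (fun w => A *ᵥ X w) (A * S * Aᴴ) where
  gaussian := hX.gaussian.map_fun (A.mulVecLin.restrictScalars ℝ).toContinuousLinearMap
  mean k := by
    simp only [Matrix.mulVec, dotProduct]
    rw [integral_finsetSum _ fun i _ => (hX.integrable_eval i).const_mul _]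
    simp only [integral_const_mul, hX.mean, mul_zero, Finset.sum_const_zero]
  covariance k l := by
    have hconj (w) : starRingEnd ℂ ((A *ᵥ X w) l) = star (A l) ⬝ᵥ star (X w) := by
      rw [star_dotProduct_star, dotProduct_comm]
      rfl
    simp only [hconj]
    rw [Matrix.mul_assoc]
    exact integral_dotProduct_mul_dotProduct hX.integrable_mul_conj hX.covariance _ _
  pseudoCovariance k l := by
    refine (integral_dotProduct_mul_dotProduct (M := 0) hX.integrable_mul hX.pseudoCovariance
      (A k) (A l)).trans ?_
    rw [zero_mulVec, dotProduct_zero]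

lemma posSemidef (hX : IsProperComplexGaussian P X S) : S.PosSemidef := by
  refine PosSemidef.of_dotProduct_mulVec_nonneg ?_ fun x => ?_
  · ext i j
    rw [conjTranspose_apply, ← hX.covariance, ← hX.covariance, Complex.star_def, ← integral_conj]
    simp only [map_mul, Complex.conj_conj, mul_comm]
  · have hquad : ∫ w, ((‖star x ⬝ᵥ X w‖ ^ 2 : ℝ) : ℂ) ∂P = star x ⬝ᵥ S *ᵥ x := by
      rw [← integral_dotProduct_mul_dotProduct hX.integrable_mul_conj hX.covariance]
      refine integral_congr_ae (.of_forall fun w => ?_)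
      have hconj : starRingEnd ℂ (star x ⬝ᵥ X w) = x ⬝ᵥ star (X w) := by
        rw [← Complex.star_def, star_dotProduct, star_star, dotProduct_comm]
      exact (Complex.ofReal_pow _ _).trans ((Complex.mul_conj' _).symm.trans (by rw [hconj]; rfl))
    rw [← hquad, integral_complex_ofReal]
    exact_mod_cast integral_nonneg fun w => sq_nonneg _

lemma integral_mul_conj_re (hX : IsProperComplexGaussian P X S) (i j : ι) :
    ∫ w, (X w i * starRingEnd ℂ (X w j)).re ∂P = (S i j).re :=
  (integral_re (hX.integrable_mul_conj i j)).trans (congrArg _ (hX.covariance i j))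

lemma integral_mul_conj_im (hX : IsProperComplexGaussian P X S) (i j : ι) :
    ∫ w, (X w i * starRingEnd ℂ (X w j)).im ∂P = (S i j).im :=
  (integral_im (hX.integrable_mul_conj i j)).trans (congrArg _ (hX.covariance i j))

lemma integral_mul_re (hX : IsProperComplexGaussian P X S) (i j : ι) :
    ∫ w, (X w i * X w j).re ∂P = 0 :=
  (integral_re (hX.integrable_mul i j)).trans (congrArg _ (hX.pseudoCovariance i j))

lemma integral_mul_im (hX : IsProperComplexGaussian P X S) (i j : ι) :
    ∫ w, (X w i * X w j).im ∂P = 0 :=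
  (integral_im (hX.integrable_mul i j)).trans (congrArg _ (hX.pseudoCovariance i j))

lemma integral_re_mul_re (hX : IsProperComplexGaussian P X S) (i j : ι) :
    ∫ w, (X w i).re * (X w j).re ∂P = (S i j).re / 2 := by
  have hpolar : (fun w => (X w i).re * (X w j).re) = fun w =>
      ((X w i * starRingEnd ℂ (X w j)).re + (X w i * X w j).re) / 2 := by
    funext w
    simp only [Complex.mul_re, Complex.conj_re, Complex.conj_im]
    ring
  rw [hpolar, integral_div, integral_add (f := fun w => (X w i * starRingEnd ℂ (X w j)).re)
    (g := fun w => (X w i * X w j).re) (hX.integrable_mul_conj i j).re (hX.integrable_mul i j).re,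
    hX.integral_mul_conj_re, hX.integral_mul_re, add_zero]

lemma integral_im_mul_im (hX : IsProperComplexGaussian P X S) (i j : ι) :
    ∫ w, (X w i).im * (X w j).im ∂P = (S i j).re / 2 := by
  have hpolar : (fun w => (X w i).im * (X w j).im) = fun w =>
      ((X w i * starRingEnd ℂ (X w j)).re - (X w i * X w j).re) / 2 := by
    funext w
    simp only [Complex.mul_re, Complex.conj_re, Complex.conj_im]
    ring
  rw [hpolar, integral_div, integral_sub (f := fun w => (X w i * starRingEnd ℂ (X w j)).re)
    (g := fun w => (X w i * X w j).re) (hX.integrable_mul_conj i j).re (hX.integrable_mul i j).re,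
    hX.integral_mul_conj_re, hX.integral_mul_re, sub_zero]

lemma integral_im_mul_re (hX : IsProperComplexGaussian P X S) (i j : ι) :
    ∫ w, (X w i).im * (X w j).re ∂P = (S i j).im / 2 := by
  have hpolar : (fun w => (X w i).im * (X w j).re) = fun w =>
      ((X w i * starRingEnd ℂ (X w j)).im + (X w i * X w j).im) / 2 := by
    funext w
    simp only [Complex.mul_im, Complex.conj_re, Complex.conj_im]
    ring
  rw [hpolar, integral_div, integral_add (f := fun w => (X w i * starRingEnd ℂ (X w j)).im)
    (g := fun w => (X w i * X w j).im) (hX.integrable_mul_conj i j).im (hX.integrable_mul i j).im,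
    hX.integral_mul_conj_im, hX.integral_mul_im, add_zero]

lemma integral_realCoords (hX : IsProperComplexGaussian P X S) (k : ι ⊕ ι) :
    ∫ w, realCoords (X w) k ∂P = 0 := by
  rcases k with i | i
  · exact (integral_re (hX.integrable_eval i)).trans (congrArg _ (hX.mean i))
  · exact (integral_im (hX.integrable_eval i)).trans (congrArg _ (hX.mean i))

variable [DecidableEq ι] {d : ι → ℝ≥0}

lemma integral_realCoords_mul
    (hX : IsProperComplexGaussian P X (diagonal fun i => ((d i : ℝ) : ℂ))) (k l : ι ⊕ ι) :
    ∫ w, realCoords (X w) k * realCoords (X w) l ∂P =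
      if k = l then ((Sum.elim d d k : ℝ≥0) : ℝ) / 2 else 0 := by
  rcases k with i | i <;> rcases l with j | j
  · refine (hX.integral_re_mul_re i j).trans ?_
    simp only [diagonal_apply, apply_ite Complex.re, Complex.ofReal_re, Complex.zero_re,
      Sum.inl.injEq, Sum.elim_inl, ite_div, zero_div]
  · refine (integral_congr_ae (.of_forall fun w => mul_comm _ _)).trans
      ((hX.integral_im_mul_re j i).trans ?_)
    simp [diagonal_apply, apply_ite Complex.im]
  · refine (hX.integral_im_mul_re i j).trans ?_
    simp [diagonal_apply, apply_ite Complex.im]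
  · refine (hX.integral_im_mul_im i j).trans ?_
    simp only [diagonal_apply, apply_ite Complex.re, Complex.ofReal_re, Complex.zero_re,
      Sum.inr.injEq, Sum.elim_inr, ite_div, zero_div]

lemma iIndepFun_realCoords
    (hX : IsProperComplexGaussian P X (diagonal fun i => ((d i : ℝ) : ℂ))) :
    iIndepFun (fun k w => realCoords (X w) k) P := by
  refine HasGaussianLaw.iIndepFun_of_covariance_eq_zero (hX.gaussian.map_fun realCoords)
    fun k l hkl => ?_
  rw [ProbabilityTheory.covariance]
  simp only [hX.integral_realCoords, sub_zero, hX.integral_realCoords_mul, if_neg hkl]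

lemma hasLaw_realCoords
    (hX : IsProperComplexGaussian P X (diagonal fun i => ((d i : ℝ) : ℂ))) (k : ι ⊕ ι) :
    HasLaw (fun w => realCoords (X w) k) (gaussianReal 0 (Sum.elim d d k / 2)) P where
  aemeasurable := (hX.gaussian.map_fun realCoords).aemeasurable.eval k
  map_eq := by
    have hk : HasGaussianLaw (fun w => realCoords (X w) k) P :=
      (hX.gaussian.map_fun realCoords).eval k
    rw [hk.map_eq_gaussianReal, hX.integral_realCoords,
      variance_of_integral_eq_zero hk.aemeasurable (hX.integral_realCoords k)]
    congr 1
    simp only [sq, hX.integral_realCoords_mul, if_true]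
    exact Real.toNNReal_coe (r := Sum.elim d d k / 2)

end IsProperComplexGaussian

variable [DecidableEq ι]

lemma realCoords_diagonal_mulVec_add (c : ι → ℝ) (x z : ι → ℂ) (k : ι ⊕ ι) :
    realCoords (diagonal (fun i => (c i : ℂ)) *ᵥ x + z) k =
      Sum.elim c c k * realCoords x k + realCoords z k := by
  cases k <;> simp [realCoords, mulVec_diagonal]

variable {b z : Ω → ι → ℂ}

lemma mutualInfo_diagonal_mulVec_add_eq_sum_realCoords {p v : ι → ℝ≥0} (c : ι → ℝ)
    (hb : IsProperComplexGaussian P b (diagonal fun i => ((p i : ℝ) : ℂ)))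
    (hz : IsProperComplexGaussian P z (diagonal fun i => ((v i : ℝ) : ℂ))) (hbz : IndepFun b z P) :
    mutualInfo P (fun w => diagonal (fun i => (c i : ℂ)) *ᵥ b w + z w) b =
      ∑ k, mutualInfo P (fun w => Sum.elim c c k * realCoords (b w) k + realCoords (z w) k)
        fun w => realCoords (b w) k := by
  have := hb.gaussian.isProbabilityMeasure
  have hy : AEMeasurable (fun w => diagonal (fun i => (c i : ℂ)) *ᵥ b w + z w) P :=
    (hb.mulVec _).gaussian.aemeasurable.add hz.gaussian.aemeasurable
  have hreal : Measurable (realCoords (ι := ι)) := realCoords.continuous.measurable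
  have hbk (k) : AEMeasurable (fun w => realCoords (b w) k) P :=
    (hb.hasLaw_realCoords k).aemeasurable
  have hzk (k) : AEMeasurable (fun w => realCoords (z w) k) P :=
    (hz.hasLaw_realCoords k).aemeasurable
  have hpair : iIndepFun (fun k w => (realCoords (b w) k, realCoords (z w) k)) P :=
    iIndepFun_prodMk hbk hzk hb.iIndepFun_realCoords hz.iIndepFun_realCoords (hbz.comp hreal hreal)
  have hparallel : iIndepFun (fun k w =>
      (Sum.elim c c k * realCoords (b w) k + realCoords (z w) k, realCoords (b w) k)) P :=
    hpair.comp (fun k q => (Sum.elim c c k * q.1 + q.2, q.1)) fun k => by fun_prop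
  rw [← mutualInfo_comp_of_leftInverse hy hb.gaussian.aemeasurable hreal measurable_ofRealCoords
    hreal measurable_ofRealCoords ofRealCoords_realCoords ofRealCoords_realCoords,
    ← mutualInfo_pi (X := fun k w => Sum.elim c c k * realCoords (b w) k + realCoords (z w) k)
      (fun k => ((hbk k).const_mul _).add (hzk k)) hbk hparallel]
  congr 1
  exact funext fun w => funext fun k => realCoords_diagonal_mulVec_add c _ _ k

lemma mutualInfo_diagonal_mulVec_add {p v : ι → ℝ≥0} {c : ι → ℝ}
    (hb : IsProperComplexGaussian P b (diagonal fun i => ((p i : ℝ) : ℂ)))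
    (hz : IsProperComplexGaussian P z (diagonal fun i => ((v i : ℝ) : ℂ))) (hbz : IndepFun b z P)
    (hvc : ∀ i, v i = 0 → c i = 0) :
    mutualInfo P (fun w => diagonal (fun i => (c i : ℂ)) *ᵥ b w + z w) b =
      ENNReal.ofReal (∑ i, Real.log (1 + c i ^ 2 * p i / v i)) := by
  have hreal (k : ι ⊕ ι) : Measurable fun x : ι → ℂ => realCoords x k :=
    (measurable_pi_apply k).comp realCoords.continuous.measurable
  have hscalar (k : ι ⊕ ι) : mutualInfo P
      (fun w => Sum.elim c c k * realCoords (b w) k + realCoords (z w) k)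
      (fun w => realCoords (b w) k) = ENNReal.ofReal (1 / 2 * Real.log
        (1 + Sum.elim c c k ^ 2 * (Sum.elim p p k : ℝ≥0) / (Sum.elim v v k : ℝ≥0))) := by
    rw [mutualInfo_gaussian _ _ (hb.hasLaw_realCoords k) (hz.hasLaw_realCoords k)
      (hbz.comp (hreal k) (hreal k)) ?_, NNReal.coe_div, NNReal.coe_div, ← mul_div_assoc,
      NNReal.coe_two, div_div_div_cancel_right₀ two_ne_zero]
    cases k <;> simpa using hvc _
  have hlog (i) : 0 ≤ 1 / 2 * Real.log (1 + c i ^ 2 * p i / v i) :=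
    mul_nonneg (by norm_num) (Real.log_nonneg (le_add_of_nonneg_right (by positivity)))
  rw [mutualInfo_diagonal_mulVec_add_eq_sum_realCoords c hb hz hbz]
  simp only [hscalar, Fintype.sum_sum_type, Sum.elim_inl, Sum.elim_inr]
  rw [← ENNReal.ofReal_sum_of_nonneg fun i _ => hlog i, ← ENNReal.ofReal_add
    (Finset.sum_nonneg fun i _ => hlog i) (Finset.sum_nonneg fun i _ => hlog i),
    ← Finset.mul_sum, ← add_mul, add_halves, one_mul]

lemma mutualInfo_conjTranspose_mulVec_add [IsProbabilityMeasure P] (H : Matrix ι ι ℂ)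
    {U : Matrix ι ι ℂ} (hU : U * Uᴴ = 1) (hb : AEMeasurable b P) (hz : AEMeasurable z P) :
    mutualInfo P (fun w => (Uᴴ * H * U) *ᵥ (Uᴴ *ᵥ b w) + Uᴴ *ᵥ z w) (fun w => Uᴴ *ᵥ b w) =
      mutualInfo P (fun w => H *ᵥ b w + z w) b := by
  have hinv : Function.LeftInverse (U *ᵥ ·) (Uᴴ *ᵥ ·) := fun x =>
    (mulVec_mulVec x U Uᴴ).trans (by rw [hU, one_mulVec])
  rw [← mutualInfo_comp_of_leftInverse (X := fun w => H *ᵥ b w + z w)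
    (((measurable_mulVec H).comp_aemeasurable hb).add hz) hb (measurable_mulVec Uᴴ)
    (measurable_mulVec U) (measurable_mulVec Uᴴ) (measurable_mulVec U) hinv hinv]
  congr 1
  funext w
  rw [mulVec_add, mulVec_mulVec, Matrix.mul_assoc, Matrix.mul_assoc, hU,
    Matrix.mul_one, ← mulVec_mulVec]

lemma mutualInfo_mulVec_add {H : Matrix ι ι ℂ} (hH : H.PosSemidef) {p N : ℝ} (hp : 0 ≤ p)
    (hN : 0 < N) (hb : IsProperComplexGaussian P b ((p : ℂ) • 1))
    (hz : IsProperComplexGaussian P z ((N : ℂ) • H)) (hbz : IndepFun b z P) :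
    mutualInfo P (fun w => H *ᵥ b w + z w) b =
      ENNReal.ofReal (logDetOneAdd (((p / N : ℝ) : ℂ) • H)) := by
  have := hb.gaussian.isProbabilityMeasure
  let U : Matrix ι ι ℂ := hH.isHermitian.eigenvectorUnitary
  have hUU : Uᴴ * U = 1 := Unitary.coe_star_mul_self hH.isHermitian.eigenvectorUnitary
  have hUU' : U * Uᴴ = 1 := Unitary.coe_mul_star_self hH.isHermitian.eigenvectorUnitary
  lift p to ℝ≥0 using hp
  let d (i : ι) : ℝ≥0 := ⟨hH.isHermitian.eigenvalues i, hH.eigenvalues_nonneg i⟩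
  have hD : Uᴴ * H * U = diagonal fun i => ((d i : ℝ) : ℂ) := by
    have h := hH.isHermitian.conjStarAlgAut_star_eigenvectorUnitary
    rwa [Unitary.conjStarAlgAut_star_apply] at h
  have hb' : IsProperComplexGaussian P (fun w => Uᴴ *ᵥ b w) (diagonal fun _ => ((p : ℝ) : ℂ)) := by
    convert hb.mulVec Uᴴ using 1
    rw [conjTranspose_conjTranspose, Matrix.mul_smul, Matrix.smul_mul, Matrix.mul_one, hUU,
      smul_one_eq_diagonal]
  have hz' : IsProperComplexGaussian P (fun w => Uᴴ *ᵥ z w)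
      (diagonal fun i => ((N.toNNReal * d i : ℝ≥0) : ℝ)) := by
    convert hz.mulVec Uᴴ using 1
    rw [conjTranspose_conjTranspose, Matrix.mul_smul, Matrix.smul_mul, hD, ← diagonal_smul]
    congr 1
    funext i
    simp [hN.le]
  rw [← mutualInfo_conjTranspose_mulVec_add H hUU' hb.gaussian.aemeasurable
    hz.gaussian.aemeasurable, hD, mutualInfo_diagonal_mulVec_add hb' hz'
    (hbz.comp (measurable_mulVec _) (measurable_mulVec _)) fun i hi => ?_,
    logDetOneAdd_smul_eq_sum_log_eigenvalues hH (by positivity)]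
  · congr! 4 with i
    have hdi : (d i : ℝ) = hH.isHermitian.eigenvalues i := rfl
    rw [NNReal.coe_mul, Real.coe_toNNReal N hN.le, ← hdi]
    rcases eq_or_ne (d i : ℝ) 0 with h0 | h0
    · simp [h0]
    · field_simp
  · simpa [hN.not_ge] using hi

end ComplexGaussian

section VectorChannel

open Matrix Filter Topology
open scoped ComplexOrder

lemma IsProperComplexGaussian.posSemidef_of_smul {Ω ι : Type*} [MeasurableSpace Ω] [Fintype ι]
    {P : Measure Ω} {X : Ω → ι → ℂ} {H : Matrix ι ι ℂ} {N : ℝ} (hN : 0 < N)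
    (hX : IsProperComplexGaussian P X ((N : ℂ) • H)) : H.PosSemidef := by
  have hinv : (0 : ℂ) ≤ (N : ℂ)⁻¹ := by exact_mod_cast inv_nonneg.2 hN.le
  simpa only [inv_smul_smul₀ (Complex.ofReal_ne_zero.2 hN.ne')] using hX.posSemidef.smul hinv

theorem theorem6_general {q : Type*} [Fintype q] [DecidableEq q] {H : ℤ → Matrix q q ℂ} {r : ℕ}
    (hH : ∀ d, H (-d) = (H d)ᴴ) (hr : ∀ d : ℤ, r < |d| → H d = 0) {p N : ℝ} (hp : 0 ≤ p)
    (hN : 0 < N) {Ω : Type*} [MeasurableSpace Ω] {P : Measure Ω} {b z : (n : ℕ) → Ω → Fin n × q → ℂ}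
    (hb : ∀ n, IsProperComplexGaussian P (b n) ((p : ℂ) • 1))
    (hz : ∀ n, IsProperComplexGaussian P (z n) ((N : ℂ) • blockToeplitz H n))
    (hbz : ∀ n, IndepFun (b n) (z n) P) :
    let information (n : ℕ) := mutualInfo P (fun w => blockToeplitz H n *ᵥ b n w + z n w) (b n)
    let logDet (n : ℕ) := logDetOneAdd (((p / N : ℝ) : ℂ) • blockToeplitz H n)
    let density (ω : ℝ) :=
      ∑ i, Real.log (1 + p / N * (isHermitian_blockSymbol (r := r) hH ω).eigenvalues i)
    (∀ n, information n ≠ ⊤ ∧ (information n).toReal = logDet n) ∧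
    IntervalIntegrable density volume (-Real.pi) Real.pi ∧
    Tendsto (fun n : ℕ => 1 / (n : ℝ) * (information n).toReal) atTop
      (𝓝 (1 / (2 * Real.pi) * ∫ ω in (-Real.pi)..Real.pi, density ω)) ∧
    Tendsto (fun n : ℕ => 1 / (n : ℝ) * logDet n) atTop
      (𝓝 (1 / (2 * Real.pi) * ∫ ω in (-Real.pi)..Real.pi, density ω)) := by
  intro information logDet density
  have hγ : 0 ≤ p / N := div_nonneg hp hN.le
  have hγ' : (0 : ℂ) ≤ ((p / N : ℝ) : ℂ) := by exact_mod_cast hγ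
  have hpos (n) : (blockToeplitz H n).PosSemidef := (hz n).posSemidef_of_smul hN
  have hsymbol (ω) : (blockSymbol H r ω).PosSemidef := posSemidef_blockSymbol hH hr hpos ω
  have hinfo (n) : information n = ENNReal.ofReal (logDet n) :=
    mutualInfo_mulVec_add (hpos n) hp hN (hb n) (hz n) (hbz n)
  have hreal (n) : (information n).toReal = logDet n := by
    rw [hinfo, ENNReal.toReal_ofReal (logDetOneAdd_nonneg ((hpos n).smul hγ'))]
  have hdensity : density = fun ω => logDetOneAdd (((p / N : ℝ) : ℂ) • blockSymbol H r ω) :=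
    funext fun ω => (logDetOneAdd_smul_eq_sum_log_eigenvalues (hsymbol ω) hγ).symm
  have hlim := tendsto_logDetOneAdd_blockToeplitz hr hsymbol hγ
  have hcont : Continuous density :=
    hdensity ▸ continuous_logDetOneAdd (f := ((p / N : ℝ) : ℂ) • blockSymbol H r)
      (continuous_blockSymbol.const_smul _) fun ω => (hsymbol ω).smul hγ'
  simp only [hreal, hdensity]
  exact ⟨fun n => ⟨hinfo n ▸ ENNReal.ofReal_ne_top, trivial⟩,
    hdensity ▸ hcont.intervalIntegrable _ _, hlim, hlim⟩

end VectorChannel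

namespace RelayLink

open Matrix

variable (L : RelayLink)

lemma t₁₁_eq_zero {d : ℤ} (hd : 2 < |d|) : L.t₁₁ d = 0 := by
  unfold t₁₁
  grind

lemma t₂₂_eq_zero {d : ℤ} (hd : 2 < |d|) : L.t₂₂ d = 0 := by
  unfold t₂₂
  grind

lemma t₁₂_eq_zero {d : ℤ} (hd : 2 < |d|) : L.t₁₂ d = 0 := by
  unfold t₁₂
  grind

lemma t₂₁_eq_zero {d : ℤ} (hd : 2 < |d|) : L.t₂₁ d = 0 := by
  rw [t₂₁, L.t₁₂_eq_zero (by rwa [abs_neg]), map_zero]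

lemma HE_eq_zero (d : ℤ) (hd : ((2 : ℕ) : ℤ) < |d|) : L.HE d = 0 := by
  unfold HE
  grind

lemma isHermitian_HE0 : L.HE0.IsHermitian := by
  ext i j
  fin_cases i <;> fin_cases j <;> simp [HE0, mul_comm]

lemma HE_neg (d : ℤ) : L.HE (-d) = (L.HE d)ᴴ := by
  have h0 := L.isHermitian_HE0.eq
  unfold HE
  split_ifs <;> first | omega | simp [h0]

lemma HE_eq (d : ℤ) : L.HE d =
    !![((‖L.α 0‖ ^ 2 : ℝ) : ℂ) * L.t₁₁ (-d), starRingEnd ℂ (L.α 0) * L.α 1 * L.t₂₁ (-d);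
       L.α 0 * starRingEnd ℂ (L.α 1) * L.t₁₂ (-d), ((‖L.α 1‖ ^ 2 : ℝ) : ℂ) * L.t₂₂ (-d)] := by
  by_cases hd : 2 < |d|
  · have hd' : 2 < |-d| := by rwa [abs_neg]
    rw [L.HE_eq_zero d (by exact_mod_cast hd), L.t₁₁_eq_zero hd', L.t₁₂_eq_zero hd',
      L.t₂₁_eq_zero hd', L.t₂₂_eq_zero hd']
    simp only [mul_zero]
    exact (etaExpand_eq _).symm
  · have hcases : d = 0 ∨ d = 1 ∨ d = -1 ∨ d = 2 ∨ d = -2 := by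
      rw [not_lt, abs_le] at hd
      omega
    rcases hcases with rfl | rfl | rfl | rfl | rfl <;> ext i j <;> fin_cases i <;> fin_cases j <;>
      simp [HE, HE0, HE1, HE2, t₁₁, t₂₂, t₂₁, t₁₂] <;> ring

lemma dtft_eq_sum {t : ℤ → ℂ} (ht : ∀ d, 2 < |d| → t d = 0) (ω : ℝ) :
    dtft t ω = ∑ d ∈ Finset.Icc (-2 : ℤ) 2, Complex.exp (Complex.I * d * ω) * t (-d) := by
  rw [dtft, ← (Equiv.neg ℤ).tsum_eq, tsum_eq_sum (s := Finset.Icc (-2) 2) fun d hd => ?_]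
  · exact Finset.sum_congr rfl fun d _ => by simp [mul_comm]
  · rw [Finset.mem_Icc, ← abs_le, not_le] at hd
    rw [Equiv.neg_apply, ht _ (by rwa [abs_neg]), zero_mul]

lemma sum_Icc_neg_two_two (f : ℤ → ℂ) :
    ∑ d ∈ Finset.Icc (-2 : ℤ) 2, f d = f (-2) + f (-1) + f 0 + f 1 + f 2 := by
  have hIcc : Finset.Icc (-2 : ℤ) 2 = {-2, -1, 0, 1, 2} := by decide
  rw [hIcc]
  simp [add_assoc]

lemma dtft_t₁₁ (ω : ℝ) : dtft L.t₁₁ ω =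
    1 + L.a₁ * Complex.exp (-(Complex.I * ω)) + L.a₁ * Complex.exp (Complex.I * ω) := by
  rw [dtft_eq_sum fun _ => L.t₁₁_eq_zero, sum_Icc_neg_two_two]
  simp [t₁₁]
  ring

lemma dtft_t₂₂ (ω : ℝ) : dtft L.t₂₂ ω =
    1 + L.d₁ * Complex.exp (-(Complex.I * ω)) + L.d₁ * Complex.exp (Complex.I * ω) := by
  rw [dtft_eq_sum fun _ => L.t₂₂_eq_zero, sum_Icc_neg_two_two]
  simp [t₂₂]
  ring

lemma dtft_t₁₂ (ω : ℝ) : dtft L.t₁₂ ω =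
    L.c₁ * Complex.exp (-(Complex.I * ω)) + L.c₂ * Complex.exp (-(Complex.I * 2 * ω)) +
      L.c₀ + L.f₁ * Complex.exp (Complex.I * ω) := by
  rw [dtft_eq_sum fun _ => L.t₁₂_eq_zero, sum_Icc_neg_two_two]
  simp [t₁₂]
  ring

lemma symbol_eq_transpose_blockSymbol (ω : ℝ) : L.symbol ω = (blockSymbol L.HE 2 ω)ᵀ := by
  rw [symbol, dtft_eq_sum fun _ => L.t₁₁_eq_zero, dtft_eq_sum fun _ => L.t₁₂_eq_zero,
    dtft_eq_sum fun _ => L.t₂₁_eq_zero, dtft_eq_sum fun _ => L.t₂₂_eq_zero]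
  ext i j
  rw [transpose_apply, blockSymbol_apply]
  simp only [HE_eq, Finset.mul_sum]
  fin_cases i <;> fin_cases j <;> simp [mul_left_comm]

lemma symbolPower_nonneg : 0 ≤ L.symbolPower :=
  mul_nonneg (by positivity) L.Ps_pos.le

lemma symbolPower_div_N0 : L.symbolPower / L.N0 = 2 / (numTransmitters : ℝ) * L.snr :=
  mul_div_assoc _ _ _

lemma logDet_eq (n : ℕ) : L.logDet n =
    logDetOneAdd (((L.symbolPower / L.N0 : ℝ) : ℂ) • blockToeplitz L.HE n) := by
  let e : Fin n ⊕ Fin n ≃ Fin n × Fin 2 :=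
    (Equiv.boolProdEquivSum (Fin n)).symm.trans ((Equiv.prodComm _ _).trans
      (Equiv.prodCongr (Equiv.refl _) finTwoEquiv.symm))
  have hl (k) : e (.inl k) = (k, 0) := rfl
  have hr (k) : e (.inr k) = (k, 1) := rfl
  have hblock : L.blockMatrix n = ((blockToeplitz L.HE n).submatrix e e)ᵀ := by
    ext (k | k) (l | l) <;> simp [hl, hr, blockToeplitz, HE_eq, blockMatrix, toeplitz]
  calc L.logDet n
      = logDetOneAdd (((L.symbolPower / L.N0 : ℝ) : ℂ) • L.blockMatrix n) := by
        rw [symbolPower_div_N0]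
        rfl
    _ = logDetOneAdd ((((L.symbolPower / L.N0 : ℝ) : ℂ) •
          blockToeplitz L.HE n).submatrix e e)ᵀ := by
        rw [hblock]
        rfl
    _ = logDetOneAdd (((L.symbolPower / L.N0 : ℝ) : ℂ) • blockToeplitz L.HE n) := by
        rw [logDetOneAdd_transpose, logDetOneAdd_reindex]

lemma rateDensity_eq (ω : ℝ) : L.rateDensity ω = ∑ i, Real.log (1 + L.symbolPower / L.N0 *
    (isHermitian_blockSymbol (r := 2) L.HE_neg ω).eigenvalues i) := by
  have heig : (L.symbol_isHermitian ω).eigenvalues =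
      (isHermitian_blockSymbol (r := 2) L.HE_neg ω).eigenvalues := by
    rw [IsHermitian.eigenvalues_eq_eigenvalues_iff, symbol_eq_transpose_blockSymbol,
      charpoly_transpose]
  let σ : Fin 2 ≃ Fin 2 := (finCongr (Fintype.card_fin 2).symm).trans
    (Fintype.equivOfCardEq (Fintype.card_fin _))
  have hσ (j) : (L.symbol_isHermitian ω).eigenvalues (σ j) = L.symbolEigenvalue ω j := by
    simp [symbolEigenvalue, IsHermitian.eigenvalues, σ]
  rw [← heig, ← σ.sum_comp, symbolPower_div_N0]
  simp only [hσ, rateDensity]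

end RelayLink

theorem theorem6 (L : RelayLink) {Ω : Type*} [MeasurableSpace Ω] (P : Measure Ω)
    (b z : (n : ℕ) → Ω → Fin n × Fin 2 → ℂ)
    (hb : ∀ n, IsProperComplexGaussian P (b n) ((L.symbolPower : ℂ) • 1))
    (hz : ∀ n, IsProperComplexGaussian P (z n) ((L.N0 : ℂ) • L.channelMatrix n))
    (hbz : ∀ n, IndepFun (b n) (z n) P) :
    -- the normalized mutual information is the normalized log-determinant
    (∀ n, mutualInfo P (L.output n (b n) (z n)) (b n) ≠ ⊤ ∧
      (mutualInfo P (L.output n (b n) (z n)) (b n)).toReal = L.logDet n) ∧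
    -- its limit
    IntervalIntegrable L.rateDensity volume (-Real.pi) Real.pi ∧
    Filter.Tendsto
      (fun n : ℕ => 1 / (n : ℝ) * (mutualInfo P (L.output n (b n) (z n)) (b n)).toReal)
      Filter.atTop
      (nhds (1 / (2 * Real.pi) * ∫ ω in (-Real.pi)..Real.pi, L.rateDensity ω)) ∧
    Filter.Tendsto (fun n : ℕ => 1 / (n : ℝ) * L.logDet n) Filter.atTop
      (nhds (1 / (2 * Real.pi) * ∫ ω in (-Real.pi)..Real.pi, L.rateDensity ω)) ∧
    -- the entries of the symbol
    (∀ ω : ℝ,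
      RelayLink.dtft L.t₁₁ ω =
        1 + L.a₁ * Complex.exp (-(Complex.I * ω)) + L.a₁ * Complex.exp (Complex.I * ω) ∧
      RelayLink.dtft L.t₁₂ ω =
        L.c₁ * Complex.exp (-(Complex.I * ω)) + L.c₂ * Complex.exp (-(Complex.I * 2 * ω)) +
          L.c₀ + L.f₁ * Complex.exp (Complex.I * ω) ∧
      RelayLink.dtft L.t₁₂ ω = starRingEnd ℂ (RelayLink.dtft L.t₂₁ ω) ∧
      RelayLink.dtft L.t₂₂ ω =
        1 + L.d₁ * Complex.exp (-(Complex.I * ω)) + L.d₁ * Complex.exp (Complex.I * ω)) := by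
  obtain ⟨hinfo, hint, hinfoLim, hlogDetLim⟩ :=
    theorem6_general L.HE_neg L.HE_eq_zero L.symbolPower_nonneg L.N0_pos hb hz hbz
  simp only [L.logDet_eq, funext L.rateDensity_eq]
  exact ⟨hinfo, hint, hinfoLim, hlogDetLim, fun ω => ⟨L.dtft_t₁₁ ω, L.dtft_t₁₂ ω,
    (RelayLink.conj_dtft L.t₂₁ L.t₁₂ (fun k => by simp [RelayLink.t₂₁]) ω).symm, L.dtft_t₂₂ ω⟩⟩
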